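/- Let $q\in\mathbb{C}$ with $0<|q|<1$, and fix a value of $q^{1/2}$. For a meromorphic function $f$ in $\mathbb{C}$, the Askey–Wilson operator is $$(\mathcal{D}_qf)(x)=\frac{f(\hat x)-f(\check x)}{\hat x-\check x},\qquad \hat x=\frac{q^{1/2}z+q^{-1/2}z^{-1}}{2},\quad \check x=\frac{q^{-1/2}z+q^{1/2}z^{-1}}{2},\quad x=\frac{z+z^{-1}}{2}\neq\pm1,$$ with $(\mathcal{D}_qf)(\pm1)=f'\bigl(\pm(q^{1/2}+q^{-1/2})/2\bigr)$; this does not depend on which of the two values $z^{\pm1}$ is used. Let $T(r,f)$ and $m(r,f)$ be the Nevanlinna characteristic and proximity function. Let $\varphi,s:(R_0,\infty)\to(0,\infty)$ be non-decreasing functions such that, for all sufficiently large $r$, $$\log r\le\varphi(r)\le r,\qquad r<s(r)\le r^2,$$ and $\liminf_{r\to\infty}s(r)/r>1$. Put $$\rho_\varphi(f)=\limsup_{r\to\infty}\frac{\log T(r,f)}{\log\varphi(r)},\qquad \alpha_{\varphi,s}=\liminf_{r\to\infty}\frac{\log\varphi(r)}{\log\varphi(s(r))},\qquad \gamma_{\varphi,s}=\liminf_{r\to\infty}\frac{\log\log\frac{s(r)}{r}}{\log\varphi(r)}.$$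 **Lemma 3.1.** Let $f$ be a meromorphic function in $\mathbb{C}$ of finite $\varphi$-order $\rho_\varphi(f)$ such that $\mathcal{D}_qf\not\equiv0$, and let $\varepsilon>0$. (a) If $\limsup_{r\to\infty}s(r)/r=\infty$ and if $s$ is convex and differentiable, then, as $r\to\infty$, $$m\left(r,\frac{\mathcal{D}_qf}{f}\right)=O\left(\frac{\varphi(s(r))^{\rho_\varphi(f)+\frac{\varepsilon}{2}}}{\log\frac{s(r)}{r}}+1\right)=O\left(\varphi(s(r))^{\rho_\varphi(f)-\alpha_{\varphi,s}\gamma_{\varphi,s}+\varepsilon}\right).$$ (b) If $\limsup_{r\to\infty}s(r)/r<\infty$ and if $\varphi$ is subadditive, i.e. $\varphi(a+b)\le\varphi(a)+\varphi(b)$ for all sufficiently large $a,b$, then, as $r\to\infty$, $$m\left(r,\frac{\mathcal{D}_qf}{f}\right)=O\left(\varphi(r)^{\rho_\varphi(f)+\varepsilon}\right).$$ -/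

import Mathlib

open Filter Topology Asymptotics Set

noncomputable section

namespace AskeyWilson

/-- The lift `z ↦ g ((z + 1/z)/2)` of a function `g` of `x = (z + 1/z)/2`. -/
def breve (g : ℂ → ℂ) (z : ℂ) : ℂ := g ((z + z⁻¹) / 2)

/-- The point `z = x + √(x² - 1)`, with the principal branch of the square root; it satisfies
`x = (z + 1/z)/2`. The other branch gives `1/z`, which yields the same operator `dq`. -/
def zOf (x : ℂ) : ℂ := x + (x ^ 2 - 1) ^ (2⁻¹ : ℂ)

/-- The Askey-Wilson divided difference operator `𝒟_q`. The parameter `p` is the chosen value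
of `q^{1/2}`. At the points `x = ±1` the value is the limit `f'(±(p + 1/p)/2)`. -/
def dq (p : ℂ) (f : ℂ → ℂ) (x : ℂ) : ℂ :=
  if x = 1 then deriv f ((p + p⁻¹) / 2)
  else if x = -1 then deriv f (-((p + p⁻¹) / 2))
  else (breve f (p * zOf x) - breve f (p⁻¹ * zOf x)) /
    (breve id (p * zOf x) - breve id (p⁻¹ * zOf x))

/-- The Nevanlinna characteristic `T(r, f)`. -/
def charT (f : ℂ → ℂ) (r : ℝ) : ℝ := ValueDistribution.characteristic f ⊤ r

/-- The Nevanlinna proximity function `m(r, f)`, the mean of `log⁺ |f|` over `|x| = r`. -/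
def proxM (f : ℂ → ℂ) (r : ℝ) : ℝ := ValueDistribution.proximity f ⊤ r

/-- The `φ`-order `limsup_{r → ∞} log T(r, f) / log φ(r)` of a non-constant meromorphic function,
in the extended reals. (For non-constant `f`, `T(r, f) → ∞`, so the real logarithm is the
right one for all large `r`.) -/
def phiOrder (φ : ℝ → ℝ) (f : ℂ → ℂ) : EReal :=
  limsup (fun r : ℝ => ((Real.log (charT f r) / Real.log (φ r) : ℝ) : EReal)) atTop

/-- The constant `α_{φ,s} = liminf_{r → ∞} log φ(r) / log φ(s(r))`. The lower limit is formed in the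
extended reals; under the standing assumptions on `φ` and `s` it lies in `[0, 1]`. -/
def alphaIdx (φ s : ℝ → ℝ) : ℝ :=
  (liminf (fun r : ℝ => ((Real.log (φ r) / Real.log (φ (s r)) : ℝ) : EReal)) atTop).toReal

/-- The constant `γ_{φ,s} = liminf_{r → ∞} log log (s(r)/r) / log φ(r)`. The lower limit is formed in
the extended reals; under the standing assumptions on `φ` and `s` it lies in `[0, 1]`. -/
def gammaIdx (φ s : ℝ → ℝ) : ℝ :=
  (liminf (fun r : ℝ =>
    ((Real.log (Real.log (s r / r)) / Real.log (φ r) : ℝ) : EReal)) atTop).toReal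

end AskeyWilson

end

section

open Real Metric MeromorphicOn Function ValueDistribution

/-! ### Algebra and size of the shifted points -/

namespace AskeyWilson

/-! Everything rests on one inequality with a free radius: m(r, 𝒟_q f / f) ≤ K((T(R, f) +
1)/log(R/r) + 1) for r ≥ K and R ≥ Kr (`exists_proxM_dq_div_le`). Since |x̂ - x̌| ≥ 1 for large x,
it suffices to bound the mean of |log|f(x̂)| - log|f(x)|| over |x| = r, and likewise for x̌.

On |x| ≤ R/2, log|f| is a sum of normalised terms log|x - c| over zeros and poles c, with
multiplicity, plus a harmonic function u. Poisson's formula bounds the variation of u by O(r/R)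
times the mean of |u|. A point c contributes O(r/(r + |c|)) in mean: for distant c because log is
Lipschitz away from 0, otherwise because (x̂ - c)(x̌ - c) = (x - ĉ)(x - č) moves the singularities
to fixed points, where Jensen's formula applies. As r/(r + |c|) · log(R/r) = O(log(R/|c|)), these
contributions add up to O((N(R, 1/f) + N(R, f))/log(R/r)), and the first main theorem leaves T(R,
f).

For (a) take R = s(r); convexity upgrades unboundedness of s(r)/r to divergence. Moreover γ ≤ ρ,
because T grows at least like log r, so the term 1 is absorbed. For (b) take R = Kr; subadditivity
gives φ(Kr) = O(φ(r)). -/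

/-- The shifted point `x̂`, computed with the branch `zOf`. -/
noncomputable def shift (p x : ℂ) : ℂ := (p * zOf x + (p * zOf x)⁻¹) / 2

/-- The principal square root of `x² - 1` entering `zOf`. -/
noncomputable def rootOf (x : ℂ) : ℂ := (x ^ 2 - 1) ^ (2⁻¹ : ℂ)

lemma rootOf_sq (x : ℂ) : rootOf x ^ 2 = x ^ 2 - 1 := by
  have := Complex.cpow_nat_inv_pow (x ^ 2 - 1) (n := 2) two_ne_zero
  simpa only [rootOf, Nat.cast_ofNat] using this

lemma zOf_inv (x : ℂ) : (zOf x)⁻¹ = x - rootOf x := by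
  refine inv_eq_of_mul_eq_one_right ?_
  change (x + rootOf x) * (x - rootOf x) = 1
  linear_combination -rootOf_sq x

lemma shift_eq (p x : ℂ) :
    shift p x = (p + p⁻¹) / 2 * x + (p - p⁻¹) / 2 * rootOf x := by
  rw [shift, mul_inv, zOf_inv, show zOf x = x + rootOf x from rfl]
  ring

lemma shift_inv_eq (p x : ℂ) :
    shift p⁻¹ x = (p + p⁻¹) / 2 * x - (p - p⁻¹) / 2 * rootOf x := by
  rw [shift_eq, inv_inv]
  ring

/-- Each shift jumps across the branch cut of `rootOf`, but a change of branch only swaps the two,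
so the product is a polynomial in x; that polynomial is symmetric in x and c. This pulls conditions
on the shifted points back to x without any change of variables. -/
lemma shift_sub_mul_shift_inv_sub {p : ℂ} (hp : p ≠ 0) (x c : ℂ) :
    (shift p x - c) * (shift p⁻¹ x - c) = (x - shift p c) * (x - shift p⁻¹ c) := by
  rw [shift_inv_eq, shift_inv_eq, shift_eq, shift_eq]
  have hp' : p * p⁻¹ = 1 := mul_inv_cancel₀ hp
  generalize p⁻¹ = p' at *
  linear_combination -((p - p') / 2) ^ 2 * rootOf_sq x + ((p - p') / 2) ^ 2 * rootOf_sq c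
    + (x ^ 2 - c ^ 2) * hp'

lemma norm_rootOf_le (x : ℂ) : ‖rootOf x‖ ≤ ‖x‖ + 1 := by
  have h : ‖rootOf x‖ ^ 2 ≤ ‖x‖ ^ 2 + 1 := by
    rw [← norm_pow, rootOf_sq]
    exact (norm_sub_le (x ^ 2) (1 : ℂ)).trans_eq (by rw [norm_pow, norm_one])
  nlinarith [norm_nonneg x, norm_nonneg (rootOf x)]

lemma norm_shift_le (p x : ℂ) : ‖shift p x‖ ≤ (‖p‖ + ‖p⁻¹‖) * (‖x‖ + 1) := by
  rw [shift_eq]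
  have h₁ : ‖(p + p⁻¹) / 2‖ ≤ (‖p‖ + ‖p⁻¹‖) / 2 := by
    rw [norm_div, Complex.norm_two]; gcongr; exact norm_add_le _ _
  have h₂ : ‖(p - p⁻¹) / 2‖ ≤ (‖p‖ + ‖p⁻¹‖) / 2 := by
    rw [norm_div, Complex.norm_two]; gcongr; exact norm_sub_le _ _
  calc _ ≤ ‖(p + p⁻¹) / 2‖ * ‖x‖ + ‖(p - p⁻¹) / 2‖ * ‖rootOf x‖ := by
        rw [← norm_mul, ← norm_mul]; exact norm_add_le _ _
    _ ≤ (‖p‖ + ‖p⁻¹‖) / 2 * (‖x‖ + 1) + (‖p‖ + ‖p⁻¹‖) / 2 * (‖x‖ + 1) := by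
        gcongr
        · linarith
        · exact norm_rootOf_le x
    _ = _ := by ring

/-- The difference is (p - 1/p)√(x² - 1), of the order of |x|. Hence the denominator of the operator
can be dropped. -/
lemma eventually_one_le_norm_shift_sub {p : ℂ} (hp : p ≠ 0) (hp1 : p ^ 2 ≠ 1) :
    ∃ r₀ : ℝ, ∀ x : ℂ, r₀ ≤ ‖x‖ → 1 ≤ ‖shift p x - shift p⁻¹ x‖ := by
  set d := ‖p - p⁻¹‖ with hd
  have hdpos : 0 < d := by
    rw [hd, norm_pos_iff, sub_ne_zero]
    intro h
    apply hp1
    rw [sq]; nth_rewrite 2 [h]; exact mul_inv_cancel₀ hp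
  refine ⟨1 + d⁻¹, fun x hx ↦ ?_⟩
  have h : shift p x - shift p⁻¹ x = (p - p⁻¹) * rootOf x := by
    rw [shift_eq, shift_inv_eq]; ring
  have h₂ : ‖x‖ ^ 2 - 1 ≤ ‖rootOf x‖ ^ 2 := by
    rw [← norm_pow (rootOf x), rootOf_sq]
    refine le_trans (le_of_eq ?_) (norm_sub_norm_le (x ^ 2) (1 : ℂ))
    rw [norm_pow, norm_one]
  have h₃ : d⁻¹ ≤ ‖rootOf x‖ := by
    have : 0 < d⁻¹ := inv_pos.2 hdpos
    refine le_of_sq_le_sq ?_ (norm_nonneg _)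
    nlinarith
  rw [h, norm_mul, ← hd]
  calc 1 = d * d⁻¹ := (mul_inv_cancel₀ hdpos.ne').symm
    _ ≤ _ := by gcongr

lemma dq_eq {p x : ℂ} (f : ℂ → ℂ) (h1 : x ≠ 1) (h2 : x ≠ -1) :
    dq p f x = (f (shift p x) - f (shift p⁻¹ x)) / (shift p x - shift p⁻¹ x) := by
  simp [dq, h1, h2, breve, shift]

end AskeyWilson

/-! ### Circle means of log|x - c| -/

lemma circleAverage_log_norm_inv_mul_sub {r : ℝ} (hr : 0 < r) (c : ℂ) :
    circleAverage (fun x : ℂ ↦ log ‖(r : ℂ)⁻¹ * (x - c)‖) 0 r = log⁺ (r⁻¹ * ‖c‖) := by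
  rw [circleAverage_eq_circleAverage_zero_one]
  have h : (fun z : ℂ ↦ log ‖(r : ℂ)⁻¹ * (r * z + 0 - c)‖) = (log ‖· - (r : ℂ)⁻¹ * c‖) := by
    ext z
    congr 2
    have : (r : ℂ) ≠ 0 := by exact_mod_cast hr.ne'
    field_simp
    ring
  rw [h, circleAverage_log_norm_sub_const_eq_posLog]
  simp [abs_of_pos hr]

lemma posLog_norm_inv_mul_sub_le {r : ℝ} (hr : 0 < r) (c : ℂ) {x : ℂ} (hx : ‖x‖ = r) :
    log⁺ ‖(r : ℂ)⁻¹ * (x - c)‖ ≤ log 2 + log⁺ (r⁻¹ * ‖c‖) := by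
  have : ‖(r : ℂ)⁻¹ * (x - c)‖ ≤ 1 + r⁻¹ * ‖c‖ := by
    rw [norm_mul, norm_inv, Complex.norm_real, norm_of_nonneg hr.le]
    calc r⁻¹ * ‖x - c‖ ≤ r⁻¹ * (‖x‖ + ‖c‖) := by gcongr; exact norm_sub_le _ _
      _ = _ := by rw [hx]; field_simp
  refine (posLog_le_posLog (norm_nonneg _) this).trans ?_
  simpa using posLog_add (x := 1) (y := r⁻¹ * ‖c‖)

lemma circleIntegrable_posLog_inv_norm_inv_mul_sub (r : ℝ) (c : ℂ) :
    CircleIntegrable (fun x : ℂ ↦ log⁺ ‖(r : ℂ)⁻¹ * (x - c)‖⁻¹) 0 r := by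
  have : MeromorphicOn (fun x : ℂ ↦ ((r : ℂ)⁻¹ * (x - c))⁻¹) (sphere 0 |r|) :=
    fun x _ ↦ by fun_prop
  simpa using this.circleIntegrable_posLog_norm

/-- Write log⁺(1/t) = log⁺ t - log t. By Jensen the mean of log t is log⁺(|c|/r), which cancels the
same term in the pointwise bound of log⁺ t, so the result is uniform in c and r. -/
lemma circleAverage_posLog_inv_norm_inv_mul_sub_le {r : ℝ} (hr : 0 < r) (c : ℂ) :
    circleAverage (fun x : ℂ ↦ log⁺ ‖(r : ℂ)⁻¹ * (x - c)‖⁻¹) 0 r ≤ log 2 := by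
  have hm : MeromorphicOn (fun x : ℂ ↦ (r : ℂ)⁻¹ * (x - c)) (sphere 0 |r|) :=
    fun x _ ↦ by fun_prop
  have h : (fun x : ℂ ↦ log⁺ ‖(r : ℂ)⁻¹ * (x - c)‖⁻¹)
      = fun x ↦ log⁺ ‖(r : ℂ)⁻¹ * (x - c)‖ - log ‖(r : ℂ)⁻¹ * (x - c)‖ := by
    ext x
    linarith [posLog_sub_posLog_inv (x := ‖(r : ℂ)⁻¹ * (x - c)‖)]
  rw [h, circleAverage_fun_sub hm.circleIntegrable_posLog_norm hm.circleIntegrable_log_norm,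
    circleAverage_log_norm_inv_mul_sub hr, sub_le_iff_le_add]
  refine circleAverage_mono_on_of_le_circle hm.circleIntegrable_posLog_norm fun x hx ↦ ?_
  exact posLog_norm_inv_mul_sub_le hr c (by simpa [abs_of_pos hr] using hx)

lemma abs_log_eq_posLog_add (y : ℝ) : |log y| = log⁺ y + log⁺ y⁻¹ := by
  rw [posLog_apply, posLog_apply, log_inv]
  rcases le_total 0 (log y) with h | h
  · rw [abs_of_nonneg h, max_eq_right h, max_eq_left (by linarith)]; ring
  · rw [abs_of_nonpos h, max_eq_left h, max_eq_right (by linarith)]; ring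

lemma circleAverage_abs_log_norm_inv_mul_sub_le {r : ℝ} (hr : 0 < r) {c : ℂ} (hc : ‖c‖ ≤ r) :
    circleAverage (fun x : ℂ ↦ |log ‖(r : ℂ)⁻¹ * (x - c)‖|) 0 r ≤ 2 * log 2 := by
  have hm : MeromorphicOn (fun x : ℂ ↦ (r : ℂ)⁻¹ * (x - c)) (sphere 0 |r|) :=
    fun x _ ↦ by fun_prop
  simp_rw [abs_log_eq_posLog_add]
  rw [circleAverage_fun_add hm.circleIntegrable_posLog_norm
    (circleIntegrable_posLog_inv_norm_inv_mul_sub r c), two_mul]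
  refine add_le_add ?_ (circleAverage_posLog_inv_norm_inv_mul_sub_le hr c)
  refine circleAverage_mono_on_of_le_circle hm.circleIntegrable_posLog_norm fun x hx ↦ ?_
  have h0 : log⁺ (r⁻¹ * ‖c‖) = 0 := by
    rw [posLog_eq_zero_iff, abs_of_nonneg (by positivity), inv_mul_le_iff₀ hr]
    simpa using hc
  simpa [h0] using posLog_norm_inv_mul_sub_le hr c (x := x) (by simpa [abs_of_pos hr] using hx)

/-! ### Variation of harmonic functions and of log|x - c| -/

/-- Poisson's formula bounds the oscillation of a harmonic function well inside a disc. -/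
lemma InnerProductSpace.HarmonicOnNhd.abs_sub_le_circleAverage_abs {u : ℂ → ℝ} {R : ℝ} {a b : ℂ}
    (hu : HarmonicOnNhd u (closedBall 0 R)) (hR : 0 < R) (ha : ‖a‖ ≤ R / 2) (hb : ‖b‖ ≤ R / 2) :
    |u a - u b| ≤ 8 * ‖a - b‖ / R * circleAverage (fun x ↦ |u x|) 0 R := by
  have ha' : a ∈ ball (0 : ℂ) R := by simp; linarith
  have hb' : b ∈ ball (0 : ℂ) R := by simp; linarith
  have hcont : ContinuousOn u (sphere 0 |R|) := by
    intro x hx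
    rw [abs_of_pos hR] at hx
    exact (hu x (sphere_subset_closedBall hx)).1.continuousAt.continuousWithinAt
  have hk : ∀ w ∈ ball (0 : ℂ) R,
      ContinuousOn (Complex.re ∘ herglotzRieszKernel 0 w) (sphere 0 |R|) := fun w hw ↦
    Complex.continuous_re.comp_continuousOn (continuousOn_herglotzRieszKernel_sphere hw)
  have hi : ∀ w ∈ ball (0 : ℂ) R,
      CircleIntegrable ((Complex.re ∘ herglotzRieszKernel 0 w) • u) 0 R := fun w hw ↦
    ((hk w hw).smul hcont).circleIntegrable'
  rw [← hu.circleAverage_re_herglotzRieszKernel_smul ha',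
    ← hu.circleAverage_re_herglotzRieszKernel_smul hb', ← circleAverage_sub (hi a ha') (hi b hb')]
  refine abs_circleAverage_le_circleAverage_abs.trans ?_
  rw [← smul_eq_mul, ← circleAverage_fun_smul]
  refine circleAverage_mono ((hi a ha').sub (hi b hb')).abs
    (ContinuousOn.circleIntegrable' (by fun_prop)) fun x hx ↦ ?_
  have hx' : ‖x‖ = R := by simpa [abs_of_pos hR] using hx
  have hxa : R / 2 ≤ ‖x - a‖ := by linarith [norm_sub_norm_le x a]
  have hxb : R / 2 ≤ ‖x - b‖ := by linarith [norm_sub_norm_le x b]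
  have hxa0 : x - a ≠ 0 := norm_pos_iff.1 (by linarith)
  have hxb0 : x - b ≠ 0 := norm_pos_iff.1 (by linarith)
  -- Both factors of the denominator are at least R/2 in modulus, so the kernels differ by at most
  -- 2R|a - b|/(R/2)² = 8|a - b|/R.
  have key : (herglotzRieszKernel 0 a x).re - (herglotzRieszKernel 0 b x).re
      = (2 * x * (a - b) / ((x - a) * (x - b))).re := by
    rw [← Complex.sub_re]
    congr 1
    simp only [herglotzRieszKernel_def, sub_zero]
    field_simp
    ring
  simp only [Pi.abs_apply, Pi.sub_apply, Pi.mul_apply, Function.comp_apply, smul_eq_mul]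
  rw [← sub_mul, key, abs_mul]
  gcongr
  refine (Complex.abs_re_le_norm _).trans ?_
  rw [norm_div, norm_mul, norm_mul, norm_mul, Complex.norm_two, hx', div_le_div_iff₀
    (mul_pos (norm_pos_iff.2 hxa0) (norm_pos_iff.2 hxb0)) hR]
  have : R / 2 * (R / 2) ≤ ‖x - a‖ * ‖x - b‖ := by gcongr
  nlinarith [norm_nonneg (a - b)]

lemma abs_log_sub_log_le {A C d m : ℝ} (hm : 0 < m) (hA : m ≤ A) (hC : m ≤ C)
    (hd : |A - C| ≤ d) : |log A - log C| ≤ d / m := by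
  have key : ∀ s t : ℝ, m ≤ s → m ≤ t → |s - t| ≤ d → log s - log t ≤ d / m := by
    intro s t hs ht h
    have ht0 : 0 < t := hm.trans_le ht
    have hs0 : 0 < s := hm.trans_le hs
    rw [← log_div hs0.ne' ht0.ne']
    refine (log_le_sub_one_of_pos (div_pos hs0 ht0)).trans ?_
    rw [div_sub_one ht0.ne']
    have := abs_nonneg (s - t)
    calc (s - t) / t ≤ d / t := by gcongr; exact (le_abs_self _).trans h
      _ ≤ d / m := by gcongr; linarith
  rw [abs_le]
  constructor
  · linarith [key C A hC hA (by rwa [abs_sub_comm])]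
  · exact key A C hA hC hd

/-- The variation of `log ‖· - c‖` between a point `x` of the circle of radius `r` and a shifted
point `ψ x` of comparable modulus is dominated by a function of small mean. -/
lemma exists_majorant_abs_log_norm_sub {ψ ψ' a b : ℂ → ℂ} {B : ℝ} (hB : 1 ≤ B)
    (hψ : ∀ x, 1 ≤ ‖x‖ → ‖ψ x‖ ≤ B * ‖x‖) (hψ' : ∀ x, 1 ≤ ‖x‖ → ‖ψ' x‖ ≤ B * ‖x‖)
    (hab : ∀ x c, (ψ x - c) * (ψ' x - c) = (x - a c) * (x - b c)) :
    ∃ K : ℝ, 0 < K ∧ ∀ r : ℝ, 1 ≤ r → ∀ c : ℂ, ∃ Φ : ℂ → ℝ, CircleIntegrable Φ 0 r ∧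
      (∀ x, ‖x‖ = r → x ≠ c → ψ x ≠ c → ψ' x ≠ c → |log ‖ψ x - c‖ - log ‖x - c‖| ≤ Φ x) ∧
      circleAverage Φ 0 r ≤ K * (r / (r + ‖c‖)) := by
  have hlB : 0 ≤ log⁺ (3 * B) := posLog_nonneg
  have hl2 : 0 < log 2 := log_pos one_lt_two
  set K₁ := 3 * log⁺ (3 * B) + 3 * log 2 with hK₁
  have hK₁0 : 0 < K₁ := by positivity
  refine ⟨K₁ * (1 + 2 * B) + 8 * B, by positivity, fun r hr c ↦ ?_⟩
  have hr0 : 0 < r := by linarith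
  have hw : 0 ≤ r / (r + ‖c‖) := by positivity
  -- For |c| ≤ 2Br the weight r/(r + |c|) is bounded below, so a bounded mean suffices. Beyond that,
  -- x and ψ x stay at distance at least |c|/2 from c, where log is Lipschitz.
  rcases le_or_gt ‖c‖ (2 * B * r) with hc | hc
  · have hI := circleIntegrable_posLog_inv_norm_inv_mul_sub r
    refine ⟨fun x ↦ 3 * log⁺ (3 * B) + log⁺ ‖(r : ℂ)⁻¹ * (x - c)‖⁻¹
      + log⁺ ‖(r : ℂ)⁻¹ * (x - a c)‖⁻¹ + log⁺ ‖(r : ℂ)⁻¹ * (x - b c)‖⁻¹, ?_, ?_, ?_⟩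
    · exact (((circleIntegrable_const _ _ _).add (hI c)).add (hI (a c))).add (hI (b c))
    · intro x hx hxc hψc hψ'c
      have n : ∀ y : ℂ, ‖(r : ℂ)⁻¹ * y‖ = r⁻¹ * ‖y‖ := fun y ↦ by
        rw [norm_mul, norm_inv, Complex.norm_real, norm_of_nonneg hr0.le]
      have bd : ∀ y : ℂ, ‖y‖ ≤ B * ‖x‖ → r⁻¹ * ‖y - c‖ ≤ 3 * B := fun y hy ↦ by
        rw [inv_mul_le_iff₀ hr0]
        have := norm_sub_le y c
        rw [hx] at hy
        nlinarith
      have hx1 : 1 ≤ ‖x‖ := hx ▸ hr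
      have b₁ := bd _ (hψ x hx1)
      have b₂ := bd _ (hψ' x hx1)
      have b₃ := bd x (by nlinarith)
      simp only [n]
      have pos : ∀ y : ℂ, y ≠ c → 0 < ‖y - c‖ := fun y hy ↦ norm_pos_iff.2 (sub_ne_zero.2 hy)
      have p₁ := pos _ hψc
      have p₂ := pos _ hψ'c
      have p₃ := pos _ hxc
      have e : log ‖ψ x - c‖ - log ‖x - c‖ = log (r⁻¹ * ‖ψ x - c‖) - log (r⁻¹ * ‖x - c‖) := by
        rw [log_mul (by positivity) p₁.ne', log_mul (by positivity) p₃.ne']; ring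
      -- The singularity at ψ x = c is traded for singularities of x at the fixed points a c and b
      -- c.
      have hprod : (r⁻¹ * ‖ψ x - c‖)⁻¹
          = (r⁻¹ * ‖x - a c‖)⁻¹ * (r⁻¹ * ‖x - b c‖)⁻¹ * (r⁻¹ * ‖ψ' x - c‖) := by
        have h := congrArg norm (hab x c)
        rw [norm_mul, norm_mul] at h
        have h0 : 0 < ‖x - a c‖ * ‖x - b c‖ := h ▸ mul_pos p₁ p₂
        have ha0 : ‖x - a c‖ ≠ 0 := fun h' ↦ by simp [h'] at h0
        have hb0 : ‖x - b c‖ ≠ 0 := fun h' ↦ by simp [h'] at h0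
        have := p₁.ne'
        field_simp
        linarith
      have i₁ : log⁺ (r⁻¹ * ‖ψ x - c‖)⁻¹ ≤ log⁺ (r⁻¹ * ‖x - a c‖)⁻¹ + log⁺ (r⁻¹ * ‖x - b c‖)⁻¹
          + log⁺ (3 * B) := by
        rw [hprod]
        refine posLog_mul.trans (add_le_add posLog_mul (posLog_le_posLog (by positivity) b₂))
      have i₂ := posLog_le_posLog (by positivity) b₁
      have i₃ := posLog_le_posLog (by positivity) b₃
      rw [e]
      refine (abs_sub _ _).trans ?_
      rw [abs_log_eq_posLog_add, abs_log_eq_posLog_add]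
      linarith
    · change circleAverage ((fun _ ↦ 3 * log⁺ (3 * B)) + (fun x ↦ log⁺ ‖(r : ℂ)⁻¹ * (x - c)‖⁻¹)
        + (fun x ↦ log⁺ ‖(r : ℂ)⁻¹ * (x - a c)‖⁻¹)
        + (fun x ↦ log⁺ ‖(r : ℂ)⁻¹ * (x - b c)‖⁻¹)) 0 r ≤ _
      rw [circleAverage_add (((circleIntegrable_const _ _ _).add (hI c)).add (hI (a c)))
        (hI (b c)), circleAverage_add ((circleIntegrable_const _ _ _).add (hI c)) (hI (a c)),
        circleAverage_add (circleIntegrable_const _ _ _) (hI c), circleAverage_const]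
      have h := circleAverage_posLog_inv_norm_inv_mul_sub_le hr0
      have h₁ : K₁ ≤ K₁ * (1 + 2 * B) * (r / (r + ‖c‖)) := by
        rw [mul_assoc]
        refine le_mul_of_one_le_right hK₁0.le ?_
        rw [mul_div_assoc', le_div_iff₀ (by positivity)]
        linarith
      have h₂ : 0 ≤ 8 * B * (r / (r + ‖c‖)) := by positivity
      linarith [h c, h (a c), h (b c)]
  · have hc0 : 0 < ‖c‖ := lt_trans (by positivity) hc
    refine ⟨fun _ ↦ 2 * B * r / (‖c‖ / 2), circleIntegrable_const _ _ _, ?_, ?_⟩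
    · intro x hx _ _ _
      have hψx := hψ x (hx ▸ hr)
      rw [hx] at hψx
      refine abs_log_sub_log_le (by positivity) ?_ ?_ ?_
      · have := norm_sub_norm_le c (ψ x)
        rw [norm_sub_rev] at this
        linarith
      · have := norm_sub_norm_le c x
        rw [norm_sub_rev] at this
        nlinarith
      · refine (abs_norm_sub_norm_le _ _).trans ?_
        rw [sub_sub_sub_cancel_right]
        have := norm_sub_le (ψ x) x
        nlinarith
    · rw [circleAverage_const]
      have h₁ : 2 * B * r / (‖c‖ / 2) ≤ 8 * B * (r / (r + ‖c‖)) := by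
        rw [mul_div_assoc', div_le_div_iff₀ (by positivity) (by positivity)]
        have : r ≤ ‖c‖ := by nlinarith
        have : 0 ≤ B * r * (‖c‖ - r) := by
          have : 0 ≤ ‖c‖ - r := by linarith
          positivity
        nlinarith
      have h₂ : 0 ≤ K₁ * (1 + 2 * B) * (r / (r + ‖c‖)) := by positivity
      linarith

/-! ### Weighted sums over zeros and poles -/

/-- Split log(R/r) = log(R/t) + log(t/r). The weight is at most 1 on the first term and makes the
second at most 1, which is below 2 log 2 ≤ 2 log(R/t) because t ≤ R/2. -/
lemma div_add_mul_log_le {r R t : ℝ} (hr : 0 < r) (ht : 0 < t) (htR : t ≤ R / 2) :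
    r / (r + t) * log (R / r) ≤ 3 * log (R * t⁻¹) := by
  have hR : 0 < R := by linarith
  have h2 : log 2 ≤ log (R * t⁻¹) := by
    refine log_le_log two_pos ?_
    rw [← div_eq_mul_inv, le_div_iff₀ ht]
    linarith
  have hl2 := log_two_gt_d9
  have e : log (R / r) = log (R * t⁻¹) + log (t / r) := by
    rw [← log_mul (by positivity) (by positivity)]
    congr 1
    field_simp
  have h₁ : log (t / r) ≤ t / r := (log_le_sub_one_of_pos (by positivity)).trans (by linarith)
  have hw1 : r / (r + t) ≤ 1 := div_le_one_of_le₀ (by linarith) (by positivity)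
  have hw0 : 0 ≤ r / (r + t) := by positivity
  have h₃ : r / (r + t) * (t / r) ≤ 1 := by
    rw [div_mul_div_comm, div_le_one (by positivity)]
    nlinarith
  rw [e, mul_add]
  have h₄ : r / (r + t) * log (t / r) ≤ 1 := (mul_le_mul_of_nonneg_left h₁ hw0).trans h₃
  have h₅ : r / (r + t) * log (R * t⁻¹) ≤ log (R * t⁻¹) :=
    mul_le_of_le_one_left (by linarith) hw1
  linarith

/-- The zeros and poles of `f`, weighted by `r / (r + |c|)`, are controlled by the logarithmic
counting functions. -/
lemma sum_abs_divisor_mul_le {f : ℂ → ℂ} {r R : ℝ} (hr : 1 ≤ r) (hR : 1 ≤ R)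
    {Z : Finset ℂ} (hZ : ∀ c ∈ Z, ‖c‖ ≤ R / 2) :
    (∑ c ∈ Z, |(divisor f univ c : ℝ)| * (r / (r + ‖c‖))) * log (R / r)
      ≤ 3 * (logCounting f 0 R + logCounting f ⊤ R) := by
  classical
  have hr0 : 0 < r := by linarith
  have hR0 : 0 < R := by linarith
  set D := divisor f univ with hD
  have hE : logCounting f 0 R + logCounting f ⊤ R
      = locallyFinsuppWithin.logCounting (D⁺ + D⁻) R := by
    rw [logCounting_zero, logCounting_top, map_add]; rfl
  set E := D⁺ + D⁻ with hEdef
  have hEv : ∀ c, (E c : ℝ) = |(D c : ℝ)| := by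
    intro c
    have : E c = |D c| := by
      rw [hEdef]
      simp [locallyFinsuppWithin.posPart_apply, locallyFinsuppWithin.negPart_apply]
      exact posPart_add_negPart (D c)
    rw [this]; push_cast; rfl
  rw [hE]
  set T := (locallyFinsuppWithin.finiteSupport (locallyFinsuppWithin.toClosedBall R E)
    (isCompact_closedBall _ _)).toFinset with hT
  have hcount : locallyFinsuppWithin.logCounting E R
      = ∑ c ∈ Z ∪ T, (locallyFinsuppWithin.toClosedBall R E c : ℝ) * log (R * ‖c‖⁻¹)
        + |(D 0 : ℝ)| * log R := by
    change ∑ᶠ z, (locallyFinsuppWithin.toClosedBall R E z : ℝ) * log (R * ‖z‖⁻¹) + E 0 * log R = _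
    rw [hEv 0, finsum_eq_sum_of_support_subset]
    intro c hc
    simp only [Finset.coe_union, mem_union]
    right
    simp only [hT, Finite.coe_toFinset]
    intro h0
    apply hc
    simp [h0]
  have hin : ∀ c, ‖c‖ ≤ R → (locallyFinsuppWithin.toClosedBall R E c : ℝ) = |(D c : ℝ)| := by
    intro c hc
    rw [locallyFinsuppWithin.toClosedBall_eval_within E (by simpa [abs_of_pos hR0] using hc), hEv]
  have hnn : ∀ c, 0 ≤ (locallyFinsuppWithin.toClosedBall R E c : ℝ) * log (R * ‖c‖⁻¹) := by
    intro c
    rcases le_or_gt ‖c‖ R with h | h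
    · rw [hin c h]
      rcases eq_or_ne c 0 with rfl | h0
      · simp
      have : 0 < ‖c‖ := norm_pos_iff.2 h0
      refine mul_nonneg (abs_nonneg _) (log_nonneg ?_)
      rwa [← div_eq_mul_inv, le_div_iff₀ this, one_mul]
    · have : locallyFinsuppWithin.toClosedBall R E c = 0 :=
        locallyFinsuppWithin.apply_eq_zero_of_notMem _ (by simpa [abs_of_pos hR0] using h)
      simp [this]
  have hlR : 0 ≤ log R := log_nonneg hR
  have hsub : ∑ c ∈ Z, (locallyFinsuppWithin.toClosedBall R E c : ℝ) * log (R * ‖c‖⁻¹)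
      ≤ ∑ c ∈ Z ∪ T, (locallyFinsuppWithin.toClosedBall R E c : ℝ) * log (R * ‖c‖⁻¹) :=
    Finset.sum_le_sum_of_subset_of_nonneg Finset.subset_union_left fun c _ _ ↦ hnn c
  -- At c = 0 the summand log(R · 0⁻¹) is 0 by convention; the origin is paid for by the separate
  -- term |D 0| log R.
  have hterm : ∀ c ∈ Z, |(D c : ℝ)| * (r / (r + ‖c‖)) * log (R / r)
      ≤ 3 * ((locallyFinsuppWithin.toClosedBall R E c : ℝ) * log (R * ‖c‖⁻¹))
        + 3 * (if c = 0 then |(D 0 : ℝ)| * log R else 0) := by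
    intro c hc
    have hcR := hZ c hc
    rw [hin c (by linarith)]
    split_ifs with h0
    · subst h0
      have : log (R / r) ≤ log R := log_le_log (by positivity) (div_le_self hR0.le hr)
      have h3 : log (R / r) ≤ 3 * log R := by linarith
      simp only [norm_zero, add_zero, div_self hr0.ne', inv_zero, mul_zero, log_zero, zero_add,
        mul_one]
      nlinarith [abs_nonneg (D 0 : ℝ)]
    · have := div_add_mul_log_le hr0 (norm_pos_iff.2 h0) hcR
      nlinarith [abs_nonneg (D c : ℝ)]
  have hite : ∑ c ∈ Z, (if c = 0 then |(D 0 : ℝ)| * log R else 0) ≤ |(D 0 : ℝ)| * log R := by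
    rw [Finset.sum_ite_eq']
    split_ifs
    · exact le_rfl
    · positivity
  calc _ = ∑ c ∈ Z, |(D c : ℝ)| * (r / (r + ‖c‖)) * log (R / r) := Finset.sum_mul _ _ _
    _ ≤ _ := Finset.sum_le_sum hterm
    _ = 3 * ∑ c ∈ Z, (locallyFinsuppWithin.toClosedBall R E c : ℝ) * log (R * ‖c‖⁻¹)
        + 3 * ∑ c ∈ Z, (if c = 0 then |(D 0 : ℝ)| * log R else 0) := by
      rw [Finset.sum_add_distrib, Finset.mul_sum, Finset.mul_sum]
    _ ≤ _ := by rw [hcount]; linarith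

/-! ### Decomposition of log|f| on a disc -/

lemma eventually_codiscreteWithin_notMem_of_finite {S : Set ℂ} (hS : S.Finite) (U : Set ℂ) :
    ∀ᶠ x in codiscreteWithin U, x ∈ U ∧ x ∉ S := by
  filter_upwards [compl_finite_mem_codiscreteWithin hS, self_mem_codiscreteWithin U] with x h₁ h₂
  exact ⟨h₂, h₁⟩

/-- A nonnegative function has circle average at most that of an integrable function dominating
it off a finite set. No integrability of the smaller function is needed. -/
lemma circleAverage_le_of_finite {F G : ℂ → ℝ} {c : ℂ} {r : ℝ} (hr : r ≠ 0)
    (hG : CircleIntegrable G c r) (hF : ∀ x, 0 ≤ F x) {S : Set ℂ} (hS : S.Finite)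
    (h : ∀ x ∈ sphere c |r|, x ∉ S → F x ≤ G x) :
    circleAverage F c r ≤ circleAverage G c r := by
  classical
  set G' : ℂ → ℝ := fun x ↦ if x ∈ S then F x else G x with hG'
  have hGG' : G =ᶠ[codiscreteWithin (sphere c |r|)] G' := by
    filter_upwards [eventually_codiscreteWithin_notMem_of_finite hS _] with x hx
    simp [hG', hx.2]
  have hle : ∀ x ∈ sphere c |r|, F x ≤ G' x := by
    intro x hx
    by_cases hxS : x ∈ S
    · simp [hG', hxS]
    · simpa [hG', hxS] using h x hx hxS
  rw [circleAverage_congr_codiscreteWithin hGG' hr]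
  by_cases hFi : CircleIntegrable F c r
  · exact circleAverage_mono hFi (hG.congr_codiscreteWithin hGG') hle
  · rw [circleAverage.integral_undef hFi]
    exact circleAverage_nonneg_of_nonneg fun x hx ↦ (hF x).trans (hle x hx)

/-- On a disc, `log ‖f‖` is the sum of the normalised logarithmic contributions of the zeros and
poles of `f` and of a harmonic function whose mean modulus on the boundary is controlled. -/
lemma exists_log_norm_eq_sum_add_harmonic {f : ℂ → ℂ} (hf : Meromorphic f)
    (hnt : ∀ z, meromorphicOrderAt f z ≠ ⊤) {R : ℝ} (hR : 0 < R) :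
    ∃ (Z : Finset ℂ) (u : ℂ → ℝ) (S : Set ℂ), S.Finite ∧ ↑Z ⊆ S ∧ (∀ c ∈ Z, ‖c‖ ≤ R) ∧
      InnerProductSpace.HarmonicOnNhd u (closedBall 0 R) ∧
      (∀ x, ‖x‖ ≤ R → x ∉ S → log ‖f x‖
        = ∑ c ∈ Z, (divisor f univ c : ℝ) * log ‖(R : ℂ)⁻¹ * (x - c)‖ + u x) ∧
      circleAverage (fun x ↦ |u x|) 0 R ≤ circleAverage (fun x ↦ |log ‖f x‖|) 0 R
        + 2 * log 2 * ∑ c ∈ Z, |(divisor f univ c : ℝ)| := by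
  set U := closedBall (0 : ℂ) R with hU
  have hfU : MeromorphicOn f U := fun x _ ↦ hf x
  have hfin := (divisor f U).finiteSupport (isCompact_closedBall 0 R)
  obtain ⟨g, hg, hg0, hfg⟩ := hfU.extract_zeros_poles (fun z ↦ hnt z) hfin
  set Z := hfin.toFinset with hZ
  have hlog : ∀ᶠ x in codiscreteWithin U,
      log ‖f x‖ = ∑ c ∈ Z, (divisor f U c : ℝ) * log ‖x - c‖ + log ‖g x‖ := by
    filter_upwards [extract_zeros_poles_log hg0 hfg] with x hx
    rw [hx, Pi.add_apply, finsum_eq_sum_of_support_subset (s := Z) _ ?_, Finset.sum_apply]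
    · intro c hc
      simp only [hZ, Finite.coe_toFinset, mem_support]
      intro h0
      apply hc
      ext x
      simp [h0]
  have hgood := (isCompact_closedBall (0 : ℂ) R).finite_sdiff_of_mem_codiscreteWithin hlog
  have hZU : ∀ c ∈ Z, c ∈ U := fun c hc ↦
    (divisor f U).supportWithinDomain (by simpa [hZ] using hc)
  have hD : ∀ c ∈ Z, divisor f U c = divisor f univ c := by
    intro c hc
    rw [divisor_apply hfU (hZU c hc), divisor_apply (fun x _ ↦ hf x) (mem_univ c)]
  -- Moving log R into the harmonic part normalises each logarithm, so that its absolute value has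
  -- mean at most 2 log 2 whatever R is.
  set κ := ∑ c ∈ Z, (divisor f univ c : ℝ) * log R with hκ
  have hrep : ∀ x, ‖x‖ ≤ R → x ∉ U \ {x | log ‖f x‖
      = ∑ c ∈ Z, (divisor f U c : ℝ) * log ‖x - c‖ + log ‖g x‖} ∪ ↑Z → log ‖f x‖
        = ∑ c ∈ Z, (divisor f univ c : ℝ) * log ‖(R : ℂ)⁻¹ * (x - c)‖ + (log ‖g x‖ + κ) := by
    intro x hx hxS
    rw [mem_union, not_or] at hxS
    have hx1 : log ‖f x‖ = ∑ c ∈ Z, (divisor f U c : ℝ) * log ‖x - c‖ + log ‖g x‖ := by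
      by_contra hcon
      exact hxS.1 ⟨by simpa [hU] using hx, hcon⟩
    rw [hx1, hκ, add_comm (log ‖g x‖), ← add_assoc, ← Finset.sum_add_distrib]
    congr 1
    refine Finset.sum_congr rfl fun c hc ↦ ?_
    have hxc : x - c ≠ 0 := sub_ne_zero.2 fun h ↦ hxS.2 (by rw [h]; exact hc)
    have : log ‖x - c‖ = log ‖(R : ℂ)⁻¹ * (x - c)‖ + log R := by
      rw [norm_mul, norm_inv, Complex.norm_real, norm_of_nonneg hR.le,
        log_mul (inv_ne_zero hR.ne') (norm_ne_zero_iff.2 hxc), log_inv]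
      ring
    rw [hD c hc, this, mul_add]
  have hharm : InnerProductSpace.HarmonicOnNhd (fun x ↦ log ‖g x‖ + κ) U := by
    have h₁ : InnerProductSpace.HarmonicOnNhd (fun x ↦ log ‖g x‖) U := fun x hx ↦
      (hg x hx).harmonicAt_log_norm (hg0 ⟨x, hx⟩)
    exact h₁.add (InnerProductSpace.harmonicOnNhd_const κ)
  have hSfin := hgood.union Z.finite_toSet
  refine ⟨Z, fun x ↦ log ‖g x‖ + κ, _, hSfin, subset_union_right,
    fun c hc ↦ by simpa [hU] using hZU c hc, hharm, hrep, ?_⟩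
  have hlogI : ∀ c : ℂ, CircleIntegrable (fun x ↦ |log ‖(R : ℂ)⁻¹ * (x - c)‖|) 0 R := by
    intro c
    have hm : MeromorphicOn (fun x : ℂ ↦ (R : ℂ)⁻¹ * (x - c)) (sphere 0 |R|) :=
      fun x _ ↦ by fun_prop
    exact hm.circleIntegrable_log_norm.abs
  have hterm : ∀ c ∈ Z, CircleIntegrable
      (fun x ↦ |(divisor f univ c : ℝ)| * |log ‖(R : ℂ)⁻¹ * (x - c)‖|) 0 R :=
    fun c _ ↦ (hlogI c).const_smul (a := |(divisor f univ c : ℝ)|)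
  have hsumI : CircleIntegrable
      (fun x ↦ ∑ c ∈ Z, |(divisor f univ c : ℝ)| * |log ‖(R : ℂ)⁻¹ * (x - c)‖|) 0 R := by
    have := CircleIntegrable.sum Z hterm
    convert this using 1
    ext x
    simp
  have hfI : CircleIntegrable (fun x ↦ |log ‖f x‖|) 0 R :=
    (show MeromorphicOn f (sphere 0 |R|) from fun x _ ↦ hf x).circleIntegrable_log_norm.abs
  refine (circleAverage_le_of_finite hR.ne' (hfI.add hsumI) (fun _ ↦ abs_nonneg _) hSfin
    fun x hx hxS ↦ ?_).trans ?_
  · have h := hrep x (by simpa [abs_of_pos hR] using (mem_sphere_zero_iff_norm.1 hx).le) hxS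
    have h' : log ‖g x‖ + κ = log ‖f x‖
        - ∑ c ∈ Z, (divisor f univ c : ℝ) * log ‖(R : ℂ)⁻¹ * (x - c)‖ := by rw [h]; ring
    rw [h']
    refine (abs_sub _ _).trans (add_le_add le_rfl ((Finset.abs_sum_le_sum_abs _ _).trans_eq ?_))
    simp_rw [abs_mul]
  · rw [circleAverage_add hfI hsumI, circleAverage_fun_sum hterm, Finset.mul_sum]
    refine add_le_add le_rfl (Finset.sum_le_sum fun c hc ↦ ?_)
    have h := circleAverage_abs_log_norm_inv_mul_sub_le hR
      (show ‖c‖ ≤ R by simpa [hU] using hZU c hc)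
    have e := circleAverage_fun_smul (a := |(divisor f univ c : ℝ)|)
      (f := fun x : ℂ ↦ |log ‖(R : ℂ)⁻¹ * (x - c)‖|) (c := 0) (R := R)
    simp only [smul_eq_mul] at e
    rw [e, mul_comm]
    gcongr

lemma circleAverage_abs_log_norm_le {f : ℂ → ℂ} (hf : Meromorphic f) {R : ℝ} (hR : 1 ≤ R) :
    circleAverage (fun x ↦ |log ‖f x‖|) 0 R ≤ characteristic f ⊤ R + characteristic f⁻¹ ⊤ R := by
  have hm : MeromorphicOn f (sphere 0 |R|) := fun x _ ↦ hf x
  have hm' : MeromorphicOn f⁻¹ (sphere 0 |R|) := fun x _ ↦ (hf x).inv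
  simp_rw [abs_log_eq_posLog_add]
  have h2 := hm'.circleIntegrable_posLog_norm
  simp only [Pi.inv_apply, norm_inv] at h2
  rw [circleAverage_fun_add hm.circleIntegrable_posLog_norm h2]
  have e₁ : circleAverage (fun x ↦ log⁺ ‖f x‖) 0 R = proximity f ⊤ R := by
    rw [proximity_top]
  have e₂ : circleAverage (fun x ↦ log⁺ ‖f x‖⁻¹) 0 R = proximity f⁻¹ ⊤ R := by
    rw [proximity_top]; simp
  rw [e₁, e₂, characteristic, characteristic, Pi.add_apply, Pi.add_apply]
  linarith [logCounting_nonneg (f := f) (e := ⊤) hR, logCounting_nonneg (f := f⁻¹) (e := ⊤) hR]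

lemma logCounting_zero_add_logCounting_top_le (f : ℂ → ℂ) (R : ℝ) :
    logCounting f 0 R + logCounting f ⊤ R ≤ characteristic f ⊤ R + characteristic f⁻¹ ⊤ R := by
  rw [characteristic, characteristic, Pi.add_apply, Pi.add_apply, logCounting_inv]
  have h₁ : 0 ≤ proximity f ⊤ R := proximity_nonneg R
  have h₂ : 0 ≤ proximity f⁻¹ ⊤ R := proximity_nonneg R
  linarith

/-! ### Variation of log|f| under a shift -/

/-- The mean variation of `log ‖f‖` between the circle of radius `r` and its image under `ψ`. -/
lemma exists_majorant_abs_log_norm_comp_sub {ψ ψ' a b : ℂ → ℂ} {B : ℝ} (hB : 1 ≤ B)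
    (hψ : ∀ x, 1 ≤ ‖x‖ → ‖ψ x‖ ≤ B * ‖x‖) (hψ' : ∀ x, 1 ≤ ‖x‖ → ‖ψ' x‖ ≤ B * ‖x‖)
    (hab : ∀ x c, (ψ x - c) * (ψ' x - c) = (x - a c) * (x - b c))
    {f : ℂ → ℂ} (hf : Meromorphic f) (hnt : ∀ z, meromorphicOrderAt f z ≠ ⊤) :
    ∃ K : ℝ, 2 ≤ K ∧ ∀ r R : ℝ, 1 ≤ r → K * r ≤ R → ∃ (Ψ : ℂ → ℝ) (S : Set ℂ), S.Finite ∧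
      CircleIntegrable Ψ 0 r ∧
      (∀ x, ‖x‖ = r → x ∉ S → |log ‖f (ψ x)‖ - log ‖f x‖| ≤ Ψ x) ∧
      circleAverage Ψ 0 r ≤ K * ((characteristic f ⊤ R + 1) / log (R / r)) := by
  obtain ⟨K₁, hK₁, hmaj⟩ := exists_majorant_abs_log_norm_sub hB hψ hψ' hab
  -- The error term of the first main theorem, bounding T(R, 1/f) by T(R, f) + C.
  set C := max |log ‖f 0‖| |log ‖meromorphicTrailingCoeffAt f 0‖| with hC
  have hC0 : 0 ≤ C := (abs_nonneg _).trans (le_max_left _ _)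
  have hinv : ∀ R, characteristic f ⊤ R + characteristic f⁻¹ ⊤ R
      ≤ 2 * characteristic f ⊤ R + C := fun R ↦ by
    have := (abs_le.1 (characteristic_sub_characteristic_inv_le hf (R := R))).1
    linarith
  set K₂ := K₁ + 64 * B * log 2 with hK₂
  have hl2 : 0 < log 2 := log_pos one_lt_two
  have hK₂0 : 0 < K₂ := by positivity
  -- The summand 4B puts ψ x within R/4, half the radius R/2 of the disc of decomposition; the rest
  -- collects the constants of the final estimate.
  refine ⟨4 * B + (3 * K₂ + 32 * B) * (2 + C), ?_, fun r R hr hRr ↦ ?_⟩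
  · have : 0 ≤ (3 * K₂ + 32 * B) * (2 + C) := by positivity
    linarith
  have hr0 : 0 < r := by linarith
  have hRB : 4 * B * r ≤ R := by
    refine le_trans ?_ hRr
    have : 0 ≤ (3 * K₂ + 32 * B) * (2 + C) * r := by positivity
    linarith
  have hR4 : 4 * r ≤ R := by nlinarith
  have hR1 : 1 ≤ R / 2 := by linarith
  have hR0 : 0 < R / 2 := by linarith
  obtain ⟨Z, u, S, hS, hZS, hZR, hu, hrep, havg⟩ := exists_log_norm_eq_sum_add_harmonic hf hnt hR0
  choose Φ hΦI hΦ hΦavg using hmaj r hr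
  set A := circleAverage (fun x ↦ |u x|) 0 (R / 2) with hA
  have hterm : ∀ c ∈ Z, CircleIntegrable (fun x ↦ |(divisor f univ c : ℝ)| * Φ c x) 0 r :=
    fun c _ ↦ (hΦI c).const_smul (a := |(divisor f univ c : ℝ)|)
  have hsumI : CircleIntegrable (fun x ↦ ∑ c ∈ Z, |(divisor f univ c : ℝ)| * Φ c x) 0 r := by
    have := CircleIntegrable.sum Z hterm
    convert this using 1
    ext x
    simp
  -- By the product identity, ψ x or ψ' x can meet S only if x lies in the image of S under a or b,
  -- so the exceptional set stays finite.
  refine ⟨fun x ↦ ∑ c ∈ Z, |(divisor f univ c : ℝ)| * Φ c x + 8 * (2 * B * r) / (R / 2) * A,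
    S ∪ a '' S ∪ b '' S, (hS.union (hS.image a)).union (hS.image b),
    hsumI.add (circleIntegrable_const _ _ _), fun x hx hxS ↦ ?_, ?_⟩
  · simp only [mem_union, not_or] at hxS
    obtain ⟨⟨hx₁, hx₂⟩, hx₃⟩ := hxS
    have hprod : ∀ c ∈ S, ψ x ≠ c ∧ ψ' x ≠ c := by
      intro c hc
      have h0 : (ψ x - c) * (ψ' x - c) ≠ 0 := by
        rw [hab]
        refine mul_ne_zero (sub_ne_zero.2 ?_) (sub_ne_zero.2 ?_)
        · rintro rfl; exact hx₂ (mem_image_of_mem a hc)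
        · rintro rfl; exact hx₃ (mem_image_of_mem b hc)
      exact ⟨sub_ne_zero.1 (left_ne_zero_of_mul h0), sub_ne_zero.1 (right_ne_zero_of_mul h0)⟩
    have hψx := hψ x (hx ▸ hr)
    rw [hx] at hψx
    have hψS : ψ x ∉ S := fun h ↦ (hprod _ h).1 rfl
    rw [hrep x (by linarith) hx₁, hrep (ψ x) (by nlinarith) hψS]
    have hosc := hu.abs_sub_le_circleAverage_abs hR0 (a := ψ x) (b := x) (by linarith)
      (by linarith)
    have hA0 : 0 ≤ A := circleAverage_nonneg_of_nonneg fun _ _ ↦ abs_nonneg _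
    have hosc' : |u (ψ x) - u x| ≤ 8 * (2 * B * r) / (R / 2) * A := by
      refine hosc.trans ?_
      have : ‖ψ x - x‖ ≤ 2 * B * r := by
        have := norm_sub_le (ψ x) x
        nlinarith
      gcongr
    rw [add_sub_add_comm, ← Finset.sum_sub_distrib]
    refine (abs_add_le _ _).trans (add_le_add ?_ hosc')
    refine (Finset.abs_sum_le_sum_abs _ _).trans (Finset.sum_le_sum fun c hc ↦ ?_)
    have hcS := hZS hc
    have hxc : x ≠ c := fun h ↦ hx₁ (h ▸ hcS)
    rw [← mul_sub, abs_mul]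
    gcongr
    refine le_trans (le_of_eq ?_) (hΦ c x hx hxc (hprod c hcS).1 (hprod c hcS).2)
    have n : ∀ y : ℂ, y ≠ c → log ‖((R / 2 : ℝ) : ℂ)⁻¹ * (y - c)‖
        = log ‖((R / 2 : ℝ) : ℂ)⁻¹‖ + log ‖y - c‖ := fun y hy ↦ by
      rw [norm_mul, log_mul _ (norm_ne_zero_iff.2 (sub_ne_zero.2 hy))]
      rw [norm_ne_zero_iff]
      exact inv_ne_zero (by exact_mod_cast hR0.ne')
    rw [n _ hxc, n _ (hprod c hcS).1]
    congr 1
    ring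
  · have hsum : circleAverage (fun x ↦ ∑ c ∈ Z, |(divisor f univ c : ℝ)| * Φ c x) 0 r
        ≤ K₁ * ∑ c ∈ Z, |(divisor f univ c : ℝ)| * (r / (r + ‖c‖)) := by
      rw [circleAverage_fun_sum hterm, Finset.mul_sum]
      refine Finset.sum_le_sum fun c _ ↦ ?_
      have e := circleAverage_fun_smul (a := |(divisor f univ c : ℝ)|) (f := Φ c) (c := 0) (R := r)
      simp only [smul_eq_mul] at e
      rw [e]
      have := mul_le_mul_of_nonneg_left (hΦavg c) (abs_nonneg (divisor f univ c : ℝ))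
      linarith
    set W := ∑ c ∈ Z, |(divisor f univ c : ℝ)| * (r / (r + ‖c‖)) with hW
    set L := log (R / r) with hL
    have hRr1 : 1 < R / r := by rw [one_lt_div hr0]; linarith
    have hL0 : 0 < L := log_pos hRr1
    set T := characteristic f ⊤ R with hT
    have hT0 : 0 ≤ T := characteristic_nonneg (by linarith)
    have hmono : characteristic f ⊤ (R / 2) ≤ T :=
      characteristic_monotoneOn hf hR0 (show (0 : ℝ) < R by linarith) (by linarith)
    have hWL : W * L ≤ 3 * (2 * T + C) := by
      refine (sum_abs_divisor_mul_le hr (by linarith) hZR).trans ?_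
      have := logCounting_zero_add_logCounting_top_le f R
      linarith [hinv R]
    -- Since r + |c| ≤ R, the number of zeros and poles entering through the mean of |u| is absorbed
    -- by the weighted sum W.
    have hrR : r / R * ∑ c ∈ Z, |(divisor f univ c : ℝ)| ≤ W := by
      rw [Finset.mul_sum]
      refine Finset.sum_le_sum fun c hc ↦ ?_
      rw [mul_comm]
      have := hZR c hc
      gcongr
      linarith
    have hrR' : r / R * L ≤ 1 := by
      have : L ≤ R / r := (log_le_sub_one_of_pos (by positivity)).trans (by linarith)
      have hR' : 0 < R := by linarith
      calc r / R * L ≤ r / R * (R / r) := by gcongr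
        _ = 1 := by field_simp
    have hA2 : A ≤ (2 * T + C) + 2 * log 2 * ∑ c ∈ Z, |(divisor f univ c : ℝ)| := by
      refine havg.trans (add_le_add ?_ le_rfl)
      have := circleAverage_abs_log_norm_le hf hR1
      linarith [hinv (R / 2)]
    have hAr : r / R * A ≤ r / R * (2 * T + C) + 2 * log 2 * W := by
      have hrR0 : 0 ≤ r / R := div_nonneg hr0.le (by linarith)
      have := mul_le_mul_of_nonneg_left hA2 hrR0
      nlinarith
    have e32 : 8 * (2 * B * r) / (R / 2) * A = 32 * B * (r / R * A) := by
      have : R ≠ 0 := by linarith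
      field_simp
      ring
    change circleAverage ((fun x ↦ ∑ c ∈ Z, |(divisor f univ c : ℝ)| * Φ c x)
      + fun _ ↦ 8 * (2 * B * r) / (R / 2) * A) 0 r ≤ _
    rw [circleAverage_add hsumI (circleIntegrable_const _ _ _), circleAverage_const, e32,
      mul_div_assoc', le_div_iff₀ hL0]
    have hTC : 2 * T + C ≤ (2 + C) * (T + 1) := by nlinarith
    have h₁ : (K₁ * W + 32 * B * (r / R * A)) * L
        ≤ (K₂ * W + 32 * B * (r / R * (2 * T + C))) * L := by
      refine mul_le_mul_of_nonneg_right ?_ hL0.le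
      have := mul_le_mul_of_nonneg_left hAr (show 0 ≤ 32 * B by linarith)
      rw [hK₂]
      linarith
    have h₂ : K₂ * W * L ≤ K₂ * (3 * (2 * T + C)) := by
      rw [mul_assoc]; gcongr
    have h₃ : 32 * B * (r / R * (2 * T + C)) * L ≤ 32 * B * (2 * T + C) := by
      have : 0 ≤ 32 * B * (2 * T + C) := by positivity
      have := mul_le_mul_of_nonneg_left hrR' this
      linarith
    have h₄ : (3 * K₂ + 32 * B) * (2 * T + C) ≤ (3 * K₂ + 32 * B) * ((2 + C) * (T + 1)) := by
      gcongr
    have h₅ : 0 ≤ 4 * B * (T + 1) := by positivity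
    have h₆ := mul_le_mul_of_nonneg_right hsum hL0.le
    linarith

/-! ### Logarithmic growth of the characteristic -/

lemma log_le_logCounting_top_of_meromorphicOrderAt_neg {f : ℂ → ℂ} (hf : Meromorphic f)
    (h : meromorphicOrderAt f 0 < 0) {r : ℝ} (hr : 1 ≤ r) : log r ≤ logCounting f ⊤ r := by
  classical
  have hD : divisor f univ 0 ≤ -1 := by
    rw [divisor_apply (fun x _ ↦ hf x) (mem_univ _)]
    obtain ⟨n, hn⟩ := WithTop.ne_top_iff_exists.1 (ne_top_of_lt h)
    rw [← hn] at h ⊢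
    have : n < 0 := by exact_mod_cast h
    simp only [WithTop.untop₀_coe]
    omega
  have hle : locallyFinsuppWithin.single (0 : ℂ) (1 : ℤ) ≤ (divisor f univ)⁻ := by
    intro z
    rw [locallyFinsuppWithin.negPart_apply, locallyFinsuppWithin.single_apply]
    split_ifs with hz
    · subst hz
      rw [negPart_def]
      exact (show (1 : ℤ) ≤ -divisor f univ 0 by omega).trans le_sup_left
    · exact negPart_nonneg _
  have := locallyFinsuppWithin.logCounting_le hle hr
  rw [locallyFinsuppWithin.logCounting_single_eq_log_sub_const (by simp; linarith)] at this
  rw [logCounting_top]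
  simpa using this

/-- The characteristic function of a nonconstant meromorphic function grows at least like the
logarithm. -/
lemma exists_log_le_characteristic_add {f : ℂ → ℂ} (hf : Meromorphic f)
    (hne : ∀ c, meromorphicOrderAt (fun z ↦ f z - c) 0 ≠ ⊤) :
    ∃ C, ∀ r, 1 ≤ r → log r ≤ characteristic f ⊤ r + C := by
  rcases lt_or_ge (meromorphicOrderAt f 0) 0 with h | h
  · refine ⟨0, fun r hr ↦ ?_⟩
    have h₁ := log_le_logCounting_top_of_meromorphicOrderAt_neg hf h hr
    have h₂ : 0 ≤ proximity f ⊤ r := proximity_nonneg r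
    rw [characteristic, Pi.add_apply]
    linarith
  -- If f has a finite limit c at 0, then 1/(f - c) has a pole there, and its characteristic differs
  -- from that of f by a bounded amount.
  · obtain ⟨c, hc⟩ := tendsto_nhds_of_meromorphicOrderAt_nonneg (hf 0) h
    have hg : Meromorphic (fun z ↦ f z - c) := fun z ↦ (hf z).sub (MeromorphicAt.const c z)
    set g := fun z ↦ f z - c with hg'
    have hpos : 0 < meromorphicOrderAt g 0 := by
      rw [← tendsto_zero_iff_meromorphicOrderAt_pos (hg 0)]
      simpa using hc.sub_const c
    have hneg : meromorphicOrderAt g⁻¹ 0 < 0 := by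
      rw [meromorphicOrderAt_inv]
      obtain ⟨n, hn⟩ := WithTop.ne_top_iff_exists.1 (hne c)
      rw [← hn] at hpos ⊢
      have : 0 < n := by exact_mod_cast hpos
      have h' : -n < 0 := by omega
      exact_mod_cast h'
    refine ⟨(log⁺ ‖c‖ + log 2) + max |log ‖g 0‖| |log ‖meromorphicTrailingCoeffAt g 0‖|,
      fun r hr ↦ ?_⟩
    have h₁ := log_le_logCounting_top_of_meromorphicOrderAt_neg (fun z ↦ (hg z).inv) hneg hr
    have h₂ : 0 ≤ proximity g⁻¹ ⊤ r := proximity_nonneg r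
    have h₃ := (abs_le.1 (characteristic_sub_characteristic_inv_le hg (R := r))).1
    have h₄ := (abs_le.1 (abs_characteristic_sub_characteristic_shift_le hf (a₀ := c) (r := r))).1
    have h₅ : characteristic g⁻¹ ⊤ r = proximity g⁻¹ ⊤ r + logCounting g⁻¹ ⊤ r := rfl
    linarith

/-! ### The estimate for the Askey-Wilson operator -/

namespace AskeyWilson

/-- If `f` is constant near some point, then `𝒟_q f` vanishes identically. -/
lemma dq_eventuallyEq_zero_of_meromorphicOrderAt_sub_eq_top {p : ℂ} (hp : p ≠ 0) {f : ℂ → ℂ}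
    (hf : Meromorphic f) {c z₀ : ℂ} (h : meromorphicOrderAt (fun z ↦ f z - c) z₀ = ⊤) :
    dq p f =ᶠ[codiscrete ℂ] 0 := by
  have hg : MeromorphicOn (fun z ↦ f z - c) univ :=
    fun z _ ↦ (hf z).sub (MeromorphicAt.const c z)
  have htop : ∀ z, meromorphicOrderAt (fun z ↦ f z - c) z = ⊤ := by
    by_contra! hcon
    obtain ⟨z, hz⟩ := hcon
    exact hg.meromorphicOrderAt_ne_top_of_isPreconnected isPreconnected_univ (mem_univ z)
      (mem_univ z₀) hz h
  have hfin : ∀ M : ℝ, {y : ℂ | ‖y‖ ≤ M ∧ f y ≠ c}.Finite := by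
    intro M
    have hcd : {y | f y = c} ∈ codiscreteWithin (closedBall (0 : ℂ) M) := by
      rw [mem_codiscreteWithin_iff_forall_mem_nhdsNE]
      intro x _
      filter_upwards [meromorphicOrderAt_eq_top_iff.1 (htop x)] with y hy
      exact Or.inl (sub_eq_zero.1 hy)
    refine ((isCompact_closedBall (0 : ℂ) M).finite_sdiff_of_mem_codiscreteWithin hcd).subset ?_
    rintro y ⟨h₁, h₂⟩
    exact ⟨by simpa using h₁, h₂⟩
  change {x | dq p f x = 0} ∈ codiscrete ℂ
  rw [codiscrete, mem_codiscreteWithin_iff_forall_mem_nhdsNE]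
  intro x₀ _
  set M := (‖p‖ + ‖p⁻¹‖) * (‖x₀‖ + 1 + 1) with hM
  -- The values of f may still differ from c at isolated points; the product identity confines the x
  -- whose shifts hit them to a finite set.
  set E := {y : ℂ | ‖y‖ ≤ M ∧ f y ≠ c} with hE
  have hEfin : (shift p '' E ∪ shift p⁻¹ '' E ∪ {1, -1}).Finite :=
    (((hfin M).image _).union ((hfin M).image _)).union (by simp)
  have hball : ∀ᶠ x in 𝓝[≠] x₀, ‖x‖ ≤ ‖x₀‖ + 1 := by
    have : ∀ᶠ x in 𝓝 x₀, ‖x‖ < ‖x₀‖ + 1 :=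
      continuous_norm.continuousAt.eventually_lt_const (by simp)
    exact (this.filter_mono nhdsWithin_le_nhds).mono fun _ hx ↦ hx.le
  have hnot : ∀ᶠ x in 𝓝[≠] x₀, x ∉ shift p '' E ∪ shift p⁻¹ '' E ∪ {1, -1} := by
    have := mem_codiscreteWithin_iff_forall_mem_nhdsNE.1
      (compl_finite_mem_codiscreteWithin (s := univ) hEfin) x₀ (mem_univ _)
    rw [compl_univ, union_empty] at this
    exact this
  filter_upwards [hball, hnot] with x hx hxE
  refine Or.inl ?_
  simp only [mem_union, not_or, mem_insert_iff, mem_singleton_iff] at hxE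
  obtain ⟨⟨h₁, h₂⟩, h₃, h₄⟩ := hxE
  have key : ∀ e ∈ E, shift p x ≠ e ∧ shift p⁻¹ x ≠ e := by
    intro e he
    have h0 : (shift p x - e) * (shift p⁻¹ x - e) ≠ 0 := by
      rw [shift_sub_mul_shift_inv_sub hp]
      refine mul_ne_zero (sub_ne_zero.2 ?_) (sub_ne_zero.2 ?_)
      · rintro rfl; exact h₁ (mem_image_of_mem _ he)
      · rintro rfl; exact h₂ (mem_image_of_mem _ he)
    exact ⟨sub_ne_zero.1 (left_ne_zero_of_mul h0), sub_ne_zero.1 (right_ne_zero_of_mul h0)⟩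
  have hb₁ : ‖shift p x‖ ≤ M := (norm_shift_le p x).trans (by rw [hM]; gcongr)
  have hb₂ : ‖shift p⁻¹ x‖ ≤ M := (norm_shift_le p⁻¹ x).trans (by
    rw [hM, inv_inv, add_comm ‖p⁻¹‖]; gcongr)
  have e₁ : f (shift p x) = c := by
    by_contra hcon
    exact (key _ ⟨hb₁, hcon⟩).1 rfl
  have e₂ : f (shift p⁻¹ x) = c := by
    by_contra hcon
    exact (key _ ⟨hb₂, hcon⟩).2 rfl
  change dq p f x = 0
  rw [dq_eq f h₃ h₄, e₁, e₂]
  simp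

/-- With log 0 = 0 and division by 0 equal to 0, no case has to be excluded at zeros of A or C. -/
lemma posLog_norm_div_le_abs_log_sub (A C : ℂ) :
    log⁺ (‖A‖ / ‖C‖) ≤ |log ‖A‖ - log ‖C‖| := by
  rcases eq_or_ne A 0 with rfl | hA
  · simp
  rcases eq_or_ne C 0 with rfl | hC
  · simp
  rw [posLog_apply, log_div (norm_ne_zero_iff.2 hA) (norm_ne_zero_iff.2 hC)]
  exact max_le (abs_nonneg _) (le_abs_self _)

/-- The logarithmic difference estimate for the Askey-Wilson operator, with an explicit free
radius `R`. -/
theorem exists_proxM_dq_div_le {p : ℂ} (hp : p ≠ 0) (hp1 : p ^ 2 ≠ 1) {f : ℂ → ℂ}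
    (hf : Meromorphic f) (hDf : ¬ dq p f =ᶠ[codiscrete ℂ] 0) :
    ∃ K : ℝ, 2 ≤ K ∧ ∀ r R : ℝ, K ≤ r → K * r ≤ R →
      proxM (fun x ↦ dq p f x / f x) r ≤ K * ((charT f R + 1) / log (R / r) + 1) := by
  have hnt : ∀ z, meromorphicOrderAt f z ≠ ⊤ := fun z hz ↦
    hDf (dq_eventuallyEq_zero_of_meromorphicOrderAt_sub_eq_top hp hf (c := 0) (z₀ := z)
      (by simpa using hz))
  set B := 2 * (‖p‖ + ‖p⁻¹‖) + 1 with hB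
  have hB1 : 1 ≤ B := by have := norm_nonneg p; have := norm_nonneg p⁻¹; linarith
  have hsh : ∀ x, 1 ≤ ‖x‖ → ‖shift p x‖ ≤ B * ‖x‖ := fun x hx ↦ by
    refine (norm_shift_le p x).trans ?_
    have : 0 ≤ ‖p‖ + ‖p⁻¹‖ := by positivity
    nlinarith
  have hsh' : ∀ x, 1 ≤ ‖x‖ → ‖shift p⁻¹ x‖ ≤ B * ‖x‖ := fun x hx ↦ by
    refine (norm_shift_le p⁻¹ x).trans ?_
    rw [inv_inv]
    have : 0 ≤ ‖p‖ + ‖p⁻¹‖ := by positivity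
    nlinarith
  obtain ⟨K₁, hK₁, h₁⟩ := exists_majorant_abs_log_norm_comp_sub hB1 hsh hsh'
    (shift_sub_mul_shift_inv_sub hp) hf hnt
  obtain ⟨K₂, hK₂, h₂⟩ := exists_majorant_abs_log_norm_comp_sub hB1 hsh' hsh
    (fun x c ↦ by rw [mul_comm, shift_sub_mul_shift_inv_sub hp]) hf hnt
  obtain ⟨r₀, hr₀⟩ := eventually_one_le_norm_shift_sub hp hp1
  refine ⟨K₁ + K₂ + |r₀|, by linarith [abs_nonneg r₀], fun r R hr hR ↦ ?_⟩
  have hr0 := le_abs_self r₀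
  have hr0' := abs_nonneg r₀
  have hr1 : 1 < r := by linarith
  obtain ⟨Ψ₁, S₁, hS₁, hΨ₁, hle₁, hav₁⟩ := h₁ r R hr1.le (by nlinarith)
  obtain ⟨Ψ₂, S₂, hS₂, hΨ₂, hle₂, hav₂⟩ := h₂ r R hr1.le (by nlinarith)
  have hI : CircleIntegrable ((fun _ ↦ log 2) + Ψ₁ + Ψ₂) 0 r :=
    ((circleIntegrable_const _ _ _).add hΨ₁).add hΨ₂
  have hav : circleAverage ((fun _ ↦ log 2) + Ψ₁ + Ψ₂) 0 r
      = log 2 + circleAverage Ψ₁ 0 r + circleAverage Ψ₂ 0 r := by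
    rw [circleAverage_add ((circleIntegrable_const _ _ _).add hΨ₁) hΨ₂,
      circleAverage_add (circleIntegrable_const _ _ _) hΨ₁, circleAverage_const]
  have hprox : proxM (fun x ↦ dq p f x / f x) r
      ≤ circleAverage ((fun _ ↦ log 2) + Ψ₁ + Ψ₂) 0 r := by
    rw [proxM, proximity_top]
    refine circleAverage_le_of_finite (by linarith) hI (fun _ ↦ posLog_nonneg) (hS₁.union hS₂)
      fun x hx hxS ↦ ?_
    rw [mem_union, not_or] at hxS
    have hxr : ‖x‖ = r := by simpa [abs_of_pos (by linarith : 0 < r)] using hx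
    have hx1 : x ≠ 1 := by rintro rfl; rw [norm_one] at hxr; linarith
    have hx2 : x ≠ -1 := by rintro rfl; rw [norm_neg, norm_one] at hxr; linarith
    have hd := hr₀ x (by linarith)
    have l₁ := hle₁ x hxr hxS.1
    have l₂ := hle₂ x hxr hxS.2
    rw [dq_eq f hx1 hx2]
    have hb : ‖(f (shift p x) - f (shift p⁻¹ x)) / (shift p x - shift p⁻¹ x) / f x‖
        ≤ ‖f (shift p x)‖ / ‖f x‖ + ‖f (shift p⁻¹ x)‖ / ‖f x‖ := by
      rw [norm_div, norm_div, ← add_div]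
      gcongr
      exact (div_le_self (norm_nonneg _) hd).trans (norm_sub_le _ _)
    refine (posLog_le_posLog (norm_nonneg _) hb).trans (posLog_add.trans ?_)
    have q₁ := posLog_norm_div_le_abs_log_sub (f (shift p x)) (f x)
    have q₂ := posLog_norm_div_le_abs_log_sub (f (shift p⁻¹ x)) (f x)
    simp only [Pi.add_apply]
    linarith
  refine hprox.trans ?_
  rw [hav]
  have hT : 0 ≤ (characteristic f ⊤ R + 1) / log (R / r) := by
    have hRr : 1 ≤ R / r := by rw [one_le_div (by linarith)]; nlinarith
    have : 0 ≤ characteristic f ⊤ R := characteristic_nonneg (by nlinarith)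
    exact div_nonneg (by linarith) (log_nonneg hRr)
  have hl2 : log 2 ≤ 1 := by linarith [log_two_lt_d9]
  change _ ≤ (K₁ + K₂ + |r₀|) * ((characteristic f ⊤ R + 1) / log (R / r) + 1)
  nlinarith [mul_nonneg hr0' hT]

end AskeyWilson

end

/-! ### Growth scales, indices and the order -/

/-- The bounds 0 and 1 keep the lower limit finite, so `toReal` loses nothing. This is applied to
both α and γ. -/
lemma toReal_liminf_coe_spec {u : ℝ → ℝ} (h0 : ∀ᶠ r in atTop, 0 ≤ u r)
    (h1 : ∀ᶠ r in atTop, u r ≤ 1) :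
    0 ≤ (liminf (fun r ↦ (u r : EReal)) atTop).toReal ∧
    (liminf (fun r ↦ (u r : EReal)) atTop).toReal ≤ 1 ∧
    ∀ δ : ℝ, 0 < δ →
      ∀ᶠ r in atTop, (liminf (fun r ↦ (u r : EReal)) atTop).toReal - δ ≤ u r := by
  set l := liminf (fun r ↦ (u r : EReal)) atTop with hl
  have hl0 : 0 ≤ l := le_liminf_of_le (h := h0.mono fun r hr ↦ by exact_mod_cast hr)
  have hl1 : l ≤ 1 := (liminf_le_limsup (f := atTop)).trans
    (limsup_le_of_le (h := h1.mono fun r hr ↦ by exact_mod_cast hr))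
  have hcoe : (l.toReal : EReal) = l := EReal.coe_toReal
    (ne_top_of_le_ne_top (EReal.coe_ne_top 1) hl1) (ne_bot_of_le_ne_bot (by simp) hl0)
  refine ⟨by exact_mod_cast hcoe ▸ hl0, by exact_mod_cast hcoe ▸ hl1, fun δ hδ ↦ ?_⟩
  have hlt : ((l.toReal - δ : ℝ) : EReal) < l := by
    rw [← hcoe]
    exact_mod_cast sub_lt_self _ hδ
  filter_upwards [eventually_lt_of_lt_liminf hlt] with r hr
  exact_mod_cast hr.le

/-- A convex function whose quotient by the identity is unbounded above is superlinear. -/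
lemma tendsto_div_atTop_of_convexOn {s : ℝ → ℝ} {R₀ : ℝ} (hs : ConvexOn ℝ (Ioi R₀) s)
    (hpos : ∀ r ∈ Ioi R₀, 0 < s r)
    (hlim : limsup (fun r : ℝ => ((s r / r : ℝ) : EReal)) atTop = ⊤) :
    Tendsto (fun r ↦ s r / r) atTop atTop := by
  rw [tendsto_atTop]
  intro M
  set a := max R₀ 0 + 1 with ha
  have haR : R₀ < a := by have := le_max_left R₀ 0; linarith
  have ha0 : 0 < a := by have := le_max_right R₀ 0; linarith
  have hsa : 0 < s a := hpos a haR
  -- Choosing b ≥ a + s(a) makes the secant slope from a to b at least 2|M|; slopes from a increase,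
  -- and r ≥ 2a costs the factor 2.
  have hfreq : ∃ᶠ r in atTop, ((2 * |M| + 1 : ℝ) : EReal) < ((s r / r : ℝ) : EReal) :=
    frequently_lt_of_lt_limsup (by isBoundedDefault) (by rw [hlim]; exact EReal.coe_lt_top _)
  obtain ⟨b, hb, hbM⟩ := (hfreq.and_eventually (eventually_ge_atTop (a + s a))).exists
  have hb' : 2 * |M| + 1 < s b / b := by exact_mod_cast hb
  have hb0 : 0 < b := by linarith
  rw [lt_div_iff₀ hb0] at hb'
  filter_upwards [eventually_gt_atTop b, eventually_ge_atTop (2 * a)] with r hr hr2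
  have hr0 : 0 < r := by linarith
  have hsl := hs.secant_mono (a := a) (x := b) (y := r) haR
    (show R₀ < b by linarith) (show R₀ < r by linarith) (by linarith) (by linarith) hr.le
  have h1 : 2 * |M| ≤ (s b - s a) / (b - a) := by
    rw [le_div_iff₀ (by linarith)]
    nlinarith [abs_nonneg M]
  have h2 := h1.trans hsl
  rw [le_div_iff₀ (by linarith)] at h2
  rw [le_div_iff₀ hr0]
  nlinarith [abs_nonneg M, le_abs_self M]

/-- A monotone subadditive scale changes by at most a constant factor under dilation. -/
lemma exists_eventually_comp_mul_le {φ : ℝ → ℝ} {R₀ : ℝ} (hmono : MonotoneOn φ (Ioi R₀))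
    (hsub : ∃ R₁ : ℝ, ∀ a b : ℝ, R₁ ≤ a → R₁ ≤ b → φ (a + b) ≤ φ a + φ b) (K : ℝ) :
    ∃ C : ℝ, 1 ≤ C ∧ ∀ᶠ r in atTop, φ (K * r) ≤ C * φ r ∨ K * r ≤ R₀ := by
  obtain ⟨R₁, hR₁⟩ := hsub
  have hpow : ∀ n : ℕ, ∀ᶠ r in atTop, φ (2 ^ n * r) ≤ 2 ^ n * φ r := by
    intro n
    filter_upwards [eventually_ge_atTop R₁, eventually_ge_atTop 0] with r hr hr0
    induction n with
    | zero => simp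
    | succ n ih =>
      have h1 : r ≤ 2 ^ n * r := le_mul_of_one_le_left hr0 (one_le_pow₀ one_le_two)
      have := hR₁ (2 ^ n * r) (2 ^ n * r) (hr.trans h1) (hr.trans h1)
      rw [show (2 : ℝ) ^ (n + 1) * r = 2 ^ n * r + 2 ^ n * r by ring, pow_succ]
      linarith
  obtain ⟨n, hn⟩ := pow_unbounded_of_one_lt K (one_lt_two (α := ℝ))
  refine ⟨2 ^ n, one_le_pow₀ one_le_two, ?_⟩
  filter_upwards [hpow n, eventually_ge_atTop 0] with r hr hr0
  rcases le_or_gt (K * r) R₀ with h | h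
  · exact Or.inr h
  · have hle : K * r ≤ 2 ^ n * r := by gcongr
    exact Or.inl ((hmono h (h.trans_le hle) hle).trans hr)

namespace AskeyWilson

lemma eventually_charT_le_rpow {φ : ℝ → ℝ} {f : ℂ → ℂ} {ρ : ℝ}
    (hφ : Tendsto φ atTop atTop) (hρ : phiOrder φ f = (ρ : EReal)) {η : ℝ} (hη : 0 < η) :
    ∀ᶠ r in atTop, charT f r ≤ φ r ^ (ρ + η) := by
  have hlt : phiOrder φ f < ((ρ + η : ℝ) : EReal) := by
    rw [hρ]; exact_mod_cast lt_add_of_pos_right ρ hη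
  filter_upwards [eventually_lt_of_limsup_lt hlt, hφ.eventually_gt_atTop 1] with r hr hr1
  have hr' : Real.log (charT f r) / Real.log (φ r) < ρ + η := by exact_mod_cast hr
  rw [div_lt_iff₀ (Real.log_pos hr1)] at hr'
  rcases le_or_gt (charT f r) 0 with h | h
  · exact h.trans (Real.rpow_nonneg (by linarith) _)
  · rw [← Real.log_le_log_iff h (Real.rpow_pos_of_pos (by linarith) _),
      Real.log_rpow (by linarith)]
    exact hr'.le

/-- A lower bound for the `φ`-order, from the logarithmic growth of `T(r, f)`. -/
lemma le_of_eventually_mul_log_le_log_log {φ : ℝ → ℝ} {f : ℂ → ℂ} {ρ : ℝ}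
    (hφ : Tendsto φ atTop atTop) (hρ : phiOrder φ f = (ρ : EReal)) {C : ℝ}
    (hT : ∀ r, 1 ≤ r → Real.log r ≤ charT f r + C) {κ : ℝ}
    (hκ : ∀ᶠ r in atTop, κ * Real.log (φ r) ≤ Real.log (Real.log r)) : κ ≤ ρ := by
  by_contra! hlt
  have hη : 0 < (κ - ρ) / 2 := by linarith
  have hlog : Tendsto (fun r ↦ Real.log (φ r)) atTop atTop := Real.tendsto_log_atTop.comp hφ
  -- With η = (κ - ρ)/2, the bounds log r / 2 ≤ T(r) ≤ φ(r)^(ρ + η) force η log φ(r) ≤ log 2,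
  -- against the third condition.
  obtain ⟨r, h₁, h₂, h₃, h₄, h₅, h₆⟩ := ((eventually_charT_le_rpow hφ hρ hη).and
    (hκ.and ((hlog.eventually_gt_atTop (Real.log 2 / ((κ - ρ) / 2))).and
    ((Real.tendsto_log_atTop.eventually_ge_atTop (2 * |C| + 1)).and
    ((eventually_ge_atTop 1).and (hφ.eventually_gt_atTop 0)))))).exists
  have hTr := hT r h₅
  have hC := le_abs_self C
  have hC0 := abs_nonneg C
  have h2 : Real.log r / 2 ≤ φ r ^ (ρ + (κ - ρ) / 2) := by linarith
  have h3 := Real.log_le_log (by linarith) h2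
  rw [Real.log_rpow h₆, Real.log_div (by linarith) two_ne_zero] at h3
  rw [div_lt_iff₀ hη] at h₃
  linarith

lemma exists_log_le_charT_add {p : ℂ} (hp : p ≠ 0) {f : ℂ → ℂ} (hf : Meromorphic f)
    (hDf : ¬ dq p f =ᶠ[codiscrete ℂ] 0) :
    ∃ C, ∀ r, 1 ≤ r → Real.log r ≤ charT f r + C :=
  exists_log_le_characteristic_add hf fun _ h ↦
    hDf (dq_eventuallyEq_zero_of_meromorphicOrderAt_sub_eq_top hp hf h)

lemma proxM_nonneg (f : ℂ → ℂ) (r : ℝ) : 0 ≤ proxM f r :=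
  ValueDistribution.proximity_nonneg r

end AskeyWilson

open AskeyWilson

/-! ### Choice of the radius R and conclusion -/

theorem lemma3p1
    -- the base `q` and a choice `p` of its square root
    (q p : ℂ) (hq0 : 0 < ‖q‖) (hq1 : ‖q‖ < 1) (hp : p ^ 2 = q)
    -- the growth scale `φ` and the auxiliary function `s` on `(R₀, ∞)`
    (R₀ : ℝ) (φ s : ℝ → ℝ)
    (hφpos : ∀ r ∈ Ioi R₀, 0 < φ r) (hφmono : MonotoneOn φ (Ioi R₀))
    (hφ : ∀ᶠ r in atTop, Real.log r ≤ φ r ∧ φ r ≤ r)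
    (hspos : ∀ r ∈ Ioi R₀, 0 < s r) (hsmono : MonotoneOn s (Ioi R₀))
    (hs : ∀ᶠ r in atTop, r < s r ∧ s r ≤ r ^ 2)
    (hsliminf : 1 < liminf (fun r : ℝ => ((s r / r : ℝ) : EReal)) atTop)
    -- `f` is meromorphic of finite `φ`-order `ρ`, and `𝒟_q f` is not the zero meromorphic function
    (f : ℂ → ℂ) (hf : Meromorphic f)
    (ρ : ℝ) (hρ : AskeyWilson.phiOrder φ f = (ρ : EReal))
    (hDf : ¬ AskeyWilson.dq p f =ᶠ[codiscrete ℂ] 0)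
    (ε : ℝ) (hε : 0 < ε) :
    (limsup (fun r : ℝ => ((s r / r : ℝ) : EReal)) atTop = ⊤ →
      ConvexOn ℝ (Ioi R₀) s → DifferentiableOn ℝ s (Ioi R₀) →
        (AskeyWilson.proxM (fun x => AskeyWilson.dq p f x / f x)
            =O[atTop] fun r => φ (s r) ^ (ρ + ε / 2) / Real.log (s r / r) + 1) ∧
        ((fun r => φ (s r) ^ (ρ + ε / 2) / Real.log (s r / r) + 1)
            =O[atTop] fun r =>
              φ (s r) ^ (ρ - AskeyWilson.alphaIdx φ s * AskeyWilson.gammaIdx φ s + ε)) ∧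
        (AskeyWilson.proxM (fun x => AskeyWilson.dq p f x / f x)
            =O[atTop] fun r =>
              φ (s r) ^ (ρ - AskeyWilson.alphaIdx φ s * AskeyWilson.gammaIdx φ s + ε))) ∧
    (limsup (fun r : ℝ => ((s r / r : ℝ) : EReal)) atTop < ⊤ →
      (∃ R₁ : ℝ, ∀ a b : ℝ, R₁ ≤ a → R₁ ≤ b → φ (a + b) ≤ φ a + φ b) →
        AskeyWilson.proxM (fun x => AskeyWilson.dq p f x / f x)
          =O[atTop] fun r => φ r ^ (ρ + ε)) := by
  have hp0 : p ≠ 0 := by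
    intro h
    rw [← hp, h] at hq0
    simp at hq0
  have hp1 : p ^ 2 ≠ 1 := by
    intro h
    rw [← hp, h, norm_one] at hq1
    exact lt_irrefl _ hq1
  have hφtop : Tendsto φ atTop atTop :=
    tendsto_atTop_mono' _ (hφ.mono fun _ h ↦ h.1) Real.tendsto_log_atTop
  have hloglog : Tendsto (fun r ↦ Real.log (Real.log r)) atTop atTop :=
    Real.tendsto_log_atTop.comp Real.tendsto_log_atTop
  obtain ⟨C, hC⟩ := exists_log_le_charT_add hp0 hf hDf
  obtain ⟨K, hK2, hK⟩ := exists_proxM_dq_div_le hp0 hp1 hf hDf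
  have hρ0 : 0 ≤ ρ := le_of_eventually_mul_log_le_log_log hφtop hρ hC (by
    filter_upwards [hloglog.eventually_ge_atTop 0] with r hr
    simpa using hr)
  have hT0 : ∀ r, 1 ≤ r → 0 ≤ charT f r := fun r hr ↦ ValueDistribution.characteristic_nonneg hr
  refine ⟨fun hlim hconv _ ↦ ?_, fun _ hsub ↦ ?_⟩
  · have hsr : Tendsto (fun r ↦ s r / r) atTop atTop :=
      tendsto_div_atTop_of_convexOn hconv hspos hlim
    have hs_atTop : Tendsto s atTop atTop :=
      tendsto_atTop_mono' _ (hs.mono fun _ h ↦ h.1.le) tendsto_id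
    have hlsr : ∀ᶠ r in atTop, 1 ≤ Real.log (s r / r) :=
      (Real.tendsto_log_atTop.comp hsr).eventually_ge_atTop 1
    have hφs : ∀ᶠ r in atTop, 1 < φ (s r) := (hφtop.comp hs_atTop).eventually_gt_atTop 1
    have hα := toReal_liminf_coe_spec (u := fun r ↦ Real.log (φ r) / Real.log (φ (s r)))
      (by
        filter_upwards [hφs, hφtop.eventually_gt_atTop 1] with r h₁ h₂
        exact div_nonneg (Real.log_nonneg h₂.le) (Real.log_nonneg h₁.le))
      (by
        filter_upwards [hφs, hφtop.eventually_gt_atTop 1, hs, eventually_gt_atTop R₀]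
          with r h₁ h₂ h₃ h₄
        exact div_le_one_of_le₀ (Real.log_le_log (by linarith)
          (hφmono h₄ (h₄.trans h₃.1) h₃.1.le)) (Real.log_nonneg h₁.le))
    have hll : ∀ᶠ r in atTop, Real.log (s r / r) ≤ Real.log r := by
      filter_upwards [hs, eventually_gt_atTop 0] with r h₁ h₂
      refine Real.log_le_log (div_pos (h₂.trans h₁.1) h₂) ?_
      rw [div_le_iff₀ h₂, ← sq]
      exact h₁.2
    have hγ := toReal_liminf_coe_spec (u := fun r ↦ Real.log (Real.log (s r / r)) / Real.log (φ r))
      (by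
        filter_upwards [hlsr, hφtop.eventually_gt_atTop 1] with r h₁ h₂
        exact div_nonneg (Real.log_nonneg h₁) (Real.log_nonneg h₂.le))
      (by
        filter_upwards [hlsr, hφtop.eventually_gt_atTop 1, hll, hφ] with r h₁ h₂ h₃ h₄
        exact div_le_one_of_le₀ (Real.log_le_log (by linarith) (h₃.trans h₄.1))
          (Real.log_nonneg h₂.le))
    change 0 ≤ alphaIdx φ s ∧ alphaIdx φ s ≤ 1 ∧ _ at hα
    change 0 ≤ gammaIdx φ s ∧ gammaIdx φ s ≤ 1 ∧ _ at hγ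
    obtain ⟨hα0, hα1, hαev⟩ := hα
    obtain ⟨hγ0, hγ1, hγev⟩ := hγ
    change ∀ δ : ℝ, 0 < δ → ∀ᶠ r in atTop,
      alphaIdx φ s - δ ≤ Real.log (φ r) / Real.log (φ (s r)) at hαev
    change ∀ δ : ℝ, 0 < δ → ∀ᶠ r in atTop,
      gammaIdx φ s - δ ≤ Real.log (Real.log (s r / r)) / Real.log (φ r) at hγev
    set α := alphaIdx φ s
    set γ := gammaIdx φ s
    -- With αγ ≤ γ this makes the exponent ρ - αγ + ε positive, so the term 1 is absorbed by the
    -- power of φ(s(r)).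
    have hγρ : γ ≤ ρ := by
      refine le_of_forall_pos_le_add fun δ hδ ↦ ?_
      have : γ - δ ≤ ρ := le_of_eventually_mul_log_le_log_log hφtop hρ hC (by
        filter_upwards [hγev δ hδ, hlsr, hll, hφtop.eventually_gt_atTop 1] with r h₁ h₂ h₃ h₄
        rw [le_div_iff₀ (Real.log_pos h₄)] at h₁
        exact h₁.trans (Real.log_le_log (by linarith) h₃))
      linarith
    have hαγ : α * γ ≤ γ := mul_le_of_le_one_left hγ0 hα1
    have first : (proxM fun x ↦ dq p f x / f x) =O[atTop]
        fun r ↦ φ (s r) ^ (ρ + ε / 2) / Real.log (s r / r) + 1 := by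
      refine IsBigO.of_bound (2 * K) ?_
      filter_upwards [hlsr, hφs, hs_atTop.eventually (eventually_charT_le_rpow hφtop hρ (half_pos hε)),
        hsr.eventually_ge_atTop K, eventually_ge_atTop K, hs] with r h₁ h₂ h₃ h₄ h₅ h₆
      have hr0 : 0 < r := by linarith
      rw [le_div_iff₀ hr0] at h₄
      have hb := hK r (s r) h₅ h₄
      have hq : 0 ≤ φ (s r) ^ (ρ + ε / 2) / Real.log (s r / r) :=
        div_nonneg (Real.rpow_nonneg (by linarith) _) (by linarith)
      have hd : (charT f (s r) + 1) / Real.log (s r / r)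
          ≤ φ (s r) ^ (ρ + ε / 2) / Real.log (s r / r) + 1 := by
        rw [add_div]
        refine add_le_add (by gcongr) ?_
        exact div_le_one_of_le₀ h₁ (by linarith)
      rw [Real.norm_of_nonneg (proxM_nonneg _ _), Real.norm_of_nonneg (by linarith)]
      refine hb.trans ?_
      nlinarith
    have second : (fun r ↦ φ (s r) ^ (ρ + ε / 2) / Real.log (s r / r) + 1) =O[atTop]
        fun r ↦ φ (s r) ^ (ρ - α * γ + ε) := by
      -- Since α, γ ≤ 1, (α - ε/4)(γ - ε/4) ≥ αγ - ε/2. When αγ > ε/2, also γ > ε/4, so the two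
      -- lower bounds may be multiplied.
      have hkey : ∀ᶠ r in atTop, φ (s r) ^ (α * γ - ε / 2) ≤ Real.log (s r / r) := by
        rcases le_or_gt (α * γ) (ε / 2) with hc | hc
        · filter_upwards [hlsr, hφs] with r h₁ h₂
          exact (Real.rpow_le_one_of_one_le_of_nonpos h₂.le (by linarith)).trans h₁
        · filter_upwards [hlsr, hφs, hφtop.eventually_gt_atTop 1, hαev (ε / 4) (by linarith),
            hγev (ε / 4) (by linarith)] with r h₁ h₂ h₃ h₄ h₅
          rw [le_div_iff₀ (Real.log_pos h₂)] at h₄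
          rw [le_div_iff₀ (Real.log_pos h₃)] at h₅
          rw [← Real.log_le_log_iff (Real.rpow_pos_of_pos (by linarith) _) (by linarith),
            Real.log_rpow (by linarith)]
          refine le_trans ?_ h₅
          have h₆ := mul_le_mul_of_nonneg_left h₄ (show 0 ≤ γ - ε / 4 by linarith)
          refine le_trans ?_ h₆
          rw [← mul_assoc]
          refine mul_le_mul_of_nonneg_right ?_ (Real.log_pos h₂).le
          nlinarith
      refine IsBigO.of_bound 2 ?_
      filter_upwards [hlsr, hφs, hkey] with r h₁ h₂ h₃
      have hφ0 : 0 < φ (s r) := by linarith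
      have hq : 0 ≤ φ (s r) ^ (ρ + ε / 2) / Real.log (s r / r) :=
        div_nonneg (Real.rpow_nonneg hφ0.le _) (by linarith)
      rw [Real.norm_of_nonneg (by linarith), Real.norm_of_nonneg (Real.rpow_nonneg hφ0.le _)]
      have i₁ : φ (s r) ^ (ρ + ε / 2) / Real.log (s r / r) ≤ φ (s r) ^ (ρ - α * γ + ε) := by
        rw [div_le_iff₀ (by linarith)]
        calc φ (s r) ^ (ρ + ε / 2) = φ (s r) ^ (ρ - α * γ + ε) * φ (s r) ^ (α * γ - ε / 2) := by
              rw [← Real.rpow_add hφ0]; congr 1; ring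
          _ ≤ _ := by gcongr
      have i₂ : 1 ≤ φ (s r) ^ (ρ - α * γ + ε) :=
        Real.one_le_rpow h₂.le (by linarith)
      linarith
    exact ⟨first, second, first.trans second⟩
  -- Here R = Kr is the smallest admissible radius, and log(R/r) is the constant log K.
  · obtain ⟨D, hD1, hD⟩ := exists_eventually_comp_mul_le hφmono hsub K
    have hKr : Tendsto (fun r : ℝ ↦ K * r) atTop atTop :=
      tendsto_id.const_mul_atTop (by linarith)
    have hlK : 0 < Real.log K := Real.log_pos (by linarith)
    refine IsBigO.of_bound (K * ((D ^ (ρ + ε) + 1) / Real.log K + 1)) ?_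
    filter_upwards [hD, hKr.eventually (eventually_charT_le_rpow hφtop hρ hε),
      hKr.eventually_gt_atTop R₀, eventually_ge_atTop K, hφtop.eventually_gt_atTop 1,
      (hφtop.comp hKr).eventually_gt_atTop 1] with r h₁ h₂ h₃ h₄ h₅ h₆
    have hφ0 : 0 < φ r := by linarith
    have h₁' : φ (K * r) ≤ D * φ r := h₁.resolve_right (not_le.2 h₃)
    have hb := hK r (K * r) h₄ le_rfl
    rw [mul_div_cancel_right₀ K (by linarith : r ≠ 0)] at hb
    have hone : 1 ≤ φ r ^ (ρ + ε) := Real.one_le_rpow h₅.le (by linarith)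
    have hT : charT f (K * r) ≤ D ^ (ρ + ε) * φ r ^ (ρ + ε) := by
      rw [← Real.mul_rpow (by linarith) hφ0.le]
      refine h₂.trans (Real.rpow_le_rpow ?_ h₁' (by linarith))
      exact (zero_lt_one.trans h₆).le
    rw [Real.norm_of_nonneg (proxM_nonneg _ _), Real.norm_of_nonneg (by linarith)]
    calc _ ≤ K * ((charT f (K * r) + 1) / Real.log K + 1) := hb
      _ ≤ K * ((D ^ (ρ + ε) * φ r ^ (ρ + ε) + φ r ^ (ρ + ε)) / Real.log K
          + φ r ^ (ρ + ε)) := by gcongr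
      _ = _ := by ring
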